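/- Let $p$ be an odd prime and let $L/K$ be an extension of degree $p$ of $p$-adic fields (finite extensions of $\mathbb{Q}_p$), with normal closure $\widetilde L$. For a $p$-adic field $F$ let $\mathcal{O}_F$ be its ring of integers and $\mathfrak{p}_F$ its maximal ideal. Let $H$ be the Hopf–Galois structure on $L/K$, that is, $H$ is a finite-dimensional cocommutative $K$-Hopf algebra acting on $L$ such that $L$ is an $H$-module algebra and the map $L\otimes_K H\to\mathrm{End}_K(L)$, $x\otimes h\mapsto (y\mapsto x(h\cdot y))$, is bijective (such a structure is known to exist and to be unique up to isomorphism; the assertions below hold for every such $H$). Let $$\mathfrak{A}_{L/K}=\{h\in H \mid h\cdot\mathcal{O}_L\subseteq\mathcal{O}_L\}$$ be the associated order of $\mathcal{O}_L$ in $H$. Let $G=\mathrm{Gal}(\widetilde L/K)$ with lower ramification groups $G_i=\{\sigma\in G \mid \sigma x\equiv x \bmod \mathfrak{p}_{\widetilde L}^{\,i+1}\ \text{for all } x\in\mathcal{O}_{\widetilde L}\}$, let $t$ be the ramification jump of $\widetilde L/K$ (the integer $t\ge -1$ with $|G_t|=p$ and $G_{t+1}=1$), let $r=[\widetilde L:L']$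 where $L'$ is the inertia field of $\widetilde L/L$, let $c$ be the remainder of $t$ modulo $r$, and let $a$ be the remainder modulo $p$ of the integer $\ell=\frac{pc(r-1)+t}{r}$. Assume that we are in the maximally ramified case, that is, $a=0$, or $L=K(\alpha)$ for some $\alpha$ such that $\alpha^p$ is a uniformizer of $K$. Then: 1. There is $\alpha\in L$ such that $L=K(\alpha)$ and $\alpha^p$ is a uniformizer of $K$. 2. For every such $\alpha$, $\mathfrak{A}_{L/K}$ has an $\mathcal{O}_K$-basis $v_0,\dots,v_{p-1}$ with $v_iv_j=\delta_{ij}v_i$ and $v_i\cdot\alpha^j=\delta_{ij}\alpha^j$ for all $0\le i,j\le p-1$. 3. $\mathfrak{A}_{L/K}$ is the maximal $\mathcal{O}_K$-order in $H$: it is an $\mathcal{O}_K$-order (an $\mathcal{O}_K$-subalgebra that is finitely generated as an $\mathcal{O}_K$-module and spans $H$ over $K$) and it contains every $\mathcal{O}_K$-order in $H$. 4. $\mathcal{O}_L$ is a free $\mathfrak{A}_{L/K}$-module. -/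

import Mathlib

noncomputable section

open scoped TensorProduct

namespace HopfGaloisPadic

/-! ### Rings of integers of `p`-adic fields and ramification groups -/

section Integers

variable (p : ℕ) [Fact p.Prime]

/-- The ring of integers `𝓞_F` of a `p`-adic field `F`: the integral closure of `ℤ_[p]` in `F`,
viewed as a subring of `F`. -/
def ringOfIntegers (F : Type*) [Field F] [Algebra ℚ_[p] F] : Subring F :=
  letI : Algebra ℤ_[p] F := Algebra.compHom F (algebraMap ℤ_[p] ℚ_[p])
  (integralClosure ℤ_[p] F).toSubring

theorem mem_ringOfIntegers {F : Type*} [Field F] [Algebra ℚ_[p] F] {x : F} :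
    x ∈ ringOfIntegers p F ↔
      ((algebraMap ℚ_[p] F).comp (algebraMap ℤ_[p] ℚ_[p])).IsIntegralElem x :=
  Iff.rfl

theorem map_mem_ringOfIntegers {E F : Type*} [Field E] [Algebra ℚ_[p] E] [Field F]
    [Algebra ℚ_[p] F] (f : E →ₐ[ℚ_[p]] F) {x : E} (hx : x ∈ ringOfIntegers p E) :
    f x ∈ ringOfIntegers p F := by
  rw [mem_ringOfIntegers] at hx ⊢
  obtain ⟨q, hq, hx⟩ := hx
  refine ⟨q, hq, ?_⟩
  have h : (algebraMap ℚ_[p] F).comp (algebraMap ℤ_[p] ℚ_[p]) =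
      (f : E →+* F).comp ((algebraMap ℚ_[p] E).comp (algebraMap ℤ_[p] ℚ_[p])) := by
    ext z
    simp
  have h2 := Polynomial.hom_eval₂ q
    ((algebraMap ℚ_[p] E).comp (algebraMap ℤ_[p] ℚ_[p])) (f : E →+* F) x
  rw [hx, map_zero] at h2
  rw [h]
  exact h2.symm

theorem smul_mem_ringOfIntegers {K L : Type*} [Field K] [Algebra ℚ_[p] K] [Field L]
    [Algebra ℚ_[p] L] [Algebra K L] [IsScalarTower ℚ_[p] K L] (c : ringOfIntegers p K)
    {x : L} (hx : x ∈ ringOfIntegers p L) : (c : K) • x ∈ ringOfIntegers p L := by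
  rw [Algebra.smul_def]
  exact mul_mem (map_mem_ringOfIntegers p (IsScalarTower.toAlgHom ℚ_[p] K L) c.2) hx

variable (K E : Type*) [Field K] [Algebra ℚ_[p] K] [Field E] [Algebra ℚ_[p] E] [Algebra K E]
  [IsScalarTower ℚ_[p] K E]

/-- The natural action of `Gal(E/K)` on `𝓞_E`. -/
instance galActionRingOfIntegers : MulSemiringAction (E ≃ₐ[K] E) (ringOfIntegers p E) where
  smul σ x := ⟨σ x, map_mem_ringOfIntegers p ((σ : E →ₐ[K] E).restrictScalars ℚ_[p]) x.2⟩
  one_smul _ := rfl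
  mul_smul _ _ _ := rfl
  smul_zero σ := Subtype.ext (map_zero σ)
  smul_add σ x y := Subtype.ext (map_add σ (x : E) (y : E))
  smul_one σ := Subtype.ext (map_one σ)
  smul_mul σ x y := Subtype.ext (map_mul σ (x : E) (y : E))

/-- The maximal ideal `𝔭_E` of `𝓞_E`. The ring `𝓞_E` is local, so its maximal ideal is its
Jacobson radical. -/
def primeIdeal (E : Type*) [Field E] [Algebra ℚ_[p] E] : Ideal (ringOfIntegers p E) :=
  Ideal.jacobson ⊥

/-- The `i`-th ramification group (lower numbering)
`G_i = {σ ∈ Gal(E/K) | σ x ≡ x mod 𝔭_E ^ (i + 1) for all x ∈ 𝓞_E}`, for `i ≥ -1`. -/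
def ramificationGroup (i : ℤ) : Subgroup (E ≃ₐ[K] E) :=
  (primeIdeal p E ^ (i + 1).toNat).inertia (E ≃ₐ[K] E)

/-- `t` is the ramification jump of `E/K`: `G_t` has order `p` and `G_{t+1}` is trivial. -/
def IsRamificationJump (t : ℤ) : Prop :=
  Nat.card (ramificationGroup p K E t) = p ∧ ramificationGroup p K E (t + 1) = ⊥

/-- The inertia field of `E/K`. -/
def inertiaField : IntermediateField K E :=
  IntermediateField.fixedField (ramificationGroup p K E 0)

end Integers

/-! ### The maximally ramified case -/

section MaximallyRamified

variable (p : ℕ) [Fact p.Prime]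

/-- The condition `a = 0` for `L/K` with normal closure `E`: here `t` is the ramification jump of
`E/K`, `r = [E : L']` with `L'` the inertia field of `E/L`, `c` is the remainder of `t` mod `r`,
`ℓ = (p c (r - 1) + t) / r` and `a` is the remainder of `ℓ` mod `p`. -/
def IsMaximallyRamified (K L E : Type*) [Field K] [Algebra ℚ_[p] K] [Field L] [Algebra ℚ_[p] L]
    [Algebra K L] [Field E] [Algebra ℚ_[p] E] [Algebra K E] [Algebra L E]
    [IsScalarTower ℚ_[p] K E] [IsScalarTower ℚ_[p] L E] : Prop :=
  ∃ t r c ℓ : ℤ, IsRamificationJump p K E t ∧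
    r = (Module.finrank (inertiaField p L E) E : ℤ) ∧
    c = t % r ∧
    r * ℓ = p * c * (r - 1) + t ∧
    ℓ % p = 0

/-- `α` is a `p`-th root of a uniformizer of `K` and `L = K(α)`. -/
def IsGeneratingRoot (K : Type*) {L : Type*} [Field K] [Algebra ℚ_[p] K] [Field L] [Algebra K L]
    (α : L) : Prop :=
  (∃ ϖ : ringOfIntegers p K, Irreducible ϖ ∧ α ^ p = algebraMap K L ϖ) ∧
    IntermediateField.adjoin K {α} = ⊤

end MaximallyRamified

/-! ### Hopf-Galois structures -/

section HopfGalois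

variable (K H L : Type*) [Field K] [Field L] [Algebra K L] [Ring H] [HopfAlgebra K H]
  [Module H L] [IsScalarTower K H L]

/-- The `K`-linear map `h ↦ (y ↦ h • y)`. -/
def actionMap : H →ₗ[K] Module.End K L where
  toFun h :=
    { toFun := fun y => h • y
      map_add' := smul_add h
      map_smul' := fun k y => by
        have := (IsScalarTower.to_smulCommClass' (R := K) (A := H) (M := L)).smul_comm h k y
        simpa using this }
  map_add' h h' := LinearMap.ext fun y => add_smul h h' y
  map_smul' k h := LinearMap.ext fun y => smul_assoc k h y

/-- The map `j : L ⊗ H → End_K(L)`, `x ⊗ h ↦ (y ↦ x (h • y))`. -/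
def jMap : L ⊗[K] H →ₗ[K] Module.End K L :=
  TensorProduct.lift
    ((LinearMap.mul K (Module.End K L)).compl₁₂ (LinearMap.mul K L) (actionMap K H L))

theorem jMap_tmul_apply (x : L) (h : H) (y : L) : jMap K H L (x ⊗ₜ h) y = x * (h • y) :=
  rfl

/-- The `K`-Hopf algebra `H` with its action on `L` is a Hopf-Galois structure on `L/K`: `H` is
finite-dimensional and cocommutative, `L` is an `H`-module algebra, and `j` is bijective. -/
structure IsHopfGalois : Prop where
  finite : Module.Finite K H
  cocomm : Coalgebra.IsCocomm K H
  /-- `h • (x y) = ∑ (h₁ • x) (h₂ • y)`, where `Δ h = ∑ h₁ ⊗ h₂`. -/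
  smul_mul : ∀ (h : H) (x y : L), h • (x * y) =
    LinearMap.mul' K L
      (TensorProduct.map ((actionMap K H L).flip x) ((actionMap K H L).flip y)
        (Coalgebra.comul (R := K) h))
  smul_one : ∀ h : H, h • (1 : L) = algebraMap K L (Coalgebra.counit (R := K) h)
  bijective : Function.Bijective (jMap K H L)

end HopfGalois

/-! ### Orders and the associated order -/

section Orders

variable (p : ℕ) [Fact p.Prime]

/-- `Λ` is an `𝓞_K`-order in the finite-dimensional `K`-algebra `A`: a subring containing the
image of `𝓞_K` which is finitely generated as an `𝓞_K`-module and spans `A` over `K`. -/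
def IsOrder (K : Type*) {A : Type*} [Field K] [Algebra ℚ_[p] K] [Ring A] [Algebra K A]
    (Λ : Subalgebra (ringOfIntegers p K) A) : Prop :=
  (Subalgebra.toSubmodule Λ).FG ∧ Submodule.span K (Λ : Set A) = ⊤

/-- `Λ` is the maximal `𝓞_K`-order in `A`: it is an order and contains every order. -/
def IsTheMaximalOrder (K : Type*) {A : Type*} [Field K] [Algebra ℚ_[p] K] [Ring A] [Algebra K A]
    (Λ : Subalgebra (ringOfIntegers p K) A) : Prop :=
  IsGreatest {Γ : Subalgebra (ringOfIntegers p K) A | IsOrder p K Γ} Λ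

variable (K H L : Type*) [Field K] [Algebra ℚ_[p] K] [Field L] [Algebra ℚ_[p] L] [Algebra K L]
  [IsScalarTower ℚ_[p] K L] [Ring H] [HopfAlgebra K H] [Module H L] [IsScalarTower K H L]

/-- The associated order `𝔄_H = {h ∈ H | h • 𝓞_L ⊆ 𝓞_L}`. -/
def associatedOrder : Subalgebra (ringOfIntegers p K) H where
  carrier := {h | ∀ x ∈ ringOfIntegers p L, h • x ∈ ringOfIntegers p L}
  mul_mem' {a b} ha hb x hx := by
    rw [mul_smul]
    exact ha _ (hb x hx)
  add_mem' {a b} ha hb x hx := by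
    rw [add_smul]
    exact add_mem (ha x hx) (hb x hx)
  algebraMap_mem' c x hx := by
    have h : algebraMap (ringOfIntegers p K) H c • x = (c : K) • x :=
      algebraMap_smul H (c : K) x
    rw [h]
    exact smul_mem_ringOfIntegers p c hx

/-- The action of `H` on `L` makes `𝓞_L` an `𝔄_H`-module. -/
instance moduleRingOfIntegers : Module (associatedOrder p K H L) (ringOfIntegers p L) where
  smul h x := ⟨(h : H) • (x : L), h.2 x x.2⟩
  one_smul x := Subtype.ext (one_smul H (x : L))
  mul_smul a b x := Subtype.ext (mul_smul (a : H) (b : H) (x : L))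
  smul_zero a := Subtype.ext (smul_zero (a : H))
  smul_add a x y := Subtype.ext (smul_add (a : H) (x : L) (y : L))
  add_smul a b x := Subtype.ext (add_smul (a : H) (b : H) (x : L))
  zero_smul x := Subtype.ext (zero_smul H (x : L))

end Orders

end HopfGaloisPadic

end

/-!
If `a = 0`, then `p` divides the ramification jump `t`. Let `σ` have order `p` in `G_t`, let `π` be
a uniformizer of `L`, and write `σ π = π (1 + w)`. The displacement `σ x - x` of
`x = ∑ cᵢ π ^ i` loses the constant term and multiplies the values of the other terms, which are
distinct, by `|w|`. Since `p ∣ t`, comparing this for `x = π ^ p` with the expansion of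
`(1 + w) ^ p - 1` shows that `π ^ p` lies in `K` up to a factor `1 + y` with
`|y| ≤ |p| |π|`. Because `z ↦ z ^ p` is additive modulo `p`, a Newton iteration makes `y` so
small that `1 + y` is a `p`-th power, and correcting `π` by its root gives `α` with `α ^ p` a
uniformizer of `K`.

Given such an `α`, let `E` be the normal closure. As an `E`-algebra, `E ⊗ L` is the convolution
algebra of linear maps `H → E`. An automorphism `σ` of `E/K` of order `p` permutes the at most `p`
characters of this algebra and fixes one of them, evaluation at `1`, so it fixes them all; likewise
it fixes `ζ = σ α / α`, as `ζ ^ p = 1`. It follows that `σ (h • α ^ k) = ζ ^ k (h • α ^ k)`, and so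
`h • α ^ k ∈ K α ^ k`. Thus `H` acts diagonally on the basis `1, α, …, α ^ (p - 1)` of `L/K`, which
is also an `𝓞_K`-basis of `𝓞_L`. Hence `H` is `K ^ p`, the associated order is its maximal order
`𝓞_K ^ p`, and the sum of the basis vectors generates `𝓞_L` freely over it.
-/

noncomputable section

open scoped TensorProduct NNReal

namespace HopfGaloisPadic

section ValuationEstimates

variable {F Γ₀ : Type*} [Field F] [LinearOrderedCommGroupWithZero Γ₀] (v : Valuation F Γ₀)

theorem valuation_natCast_le_one (n : ℕ) : v n ≤ 1 := by
  induction n with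
  | zero => simp
  | succ n ih => rw [Nat.cast_succ]; exact v.map_add_le ih v.map_one.le

theorem valuation_natCast_mul_le (n : ℕ) (x : F) : v (n * x) ≤ v x := by
  rw [map_mul]
  exact mul_le_of_le_one_left' (valuation_natCast_le_one v n)

theorem exists_valuation_sum_eq {ι : Type*} {s : Finset ι} {f : ι → F} (hs : s.Nonempty)
    (hf : Set.InjOn (fun i => v (f i)) {i | i ∈ s ∧ f i ≠ 0}) :
    ∃ i ∈ s, v (∑ j ∈ s, f j) = v (f i) ∧ ∀ j ∈ s, v (f j) ≤ v (f i) := by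
  classical
  obtain ⟨i, hi, hmax⟩ := s.exists_max_image (fun i => v (f i)) hs
  refine ⟨i, hi, ?_, hmax⟩
  obtain h0 | h0 := eq_or_ne (f i) 0
  · rw [h0, map_zero] at hmax ⊢
    exact le_zero_iff.1 (v.map_sum_le hmax)
  refine v.map_sum_eq_of_lt hi fun j hj => ?_
  obtain ⟨hj, hji⟩ := Finset.mem_sdiff.1 hj
  refine (hmax j hj).lt_of_ne fun h => hji (Finset.mem_singleton.2 (hf ⟨hj, ?_⟩ ⟨hi, h0⟩ h))
  exact v.ne_zero_iff.1 (h ▸ v.ne_zero_iff.2 h0)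

theorem valuation_le_valuation_sum {ι : Type*} {s : Finset ι} {f : ι → F}
    (hf : Set.InjOn (fun i => v (f i)) {i | i ∈ s ∧ f i ≠ 0}) {i : ι} (hi : i ∈ s) :
    v (f i) ≤ v (∑ j ∈ s, f j) := by
  obtain ⟨j, -, hj, hmax⟩ := exists_valuation_sum_eq v ⟨i, hi⟩ hf
  exact hj ▸ hmax i hi

theorem valuation_sum_eq_mul {ι : Type*} {s : Finset ι} {f g : ι → F} {γ : Γ₀}
    (hf : Set.InjOn (fun i => v (f i)) {i | i ∈ s ∧ f i ≠ 0})
    (hg : ∀ i ∈ s, v (g i) = v (f i) * γ) : v (∑ i ∈ s, g i) = v (∑ i ∈ s, f i) * γ := by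
  obtain rfl | hs := s.eq_empty_or_nonempty
  · simp
  obtain rfl | hγ := eq_or_ne γ 0
  · simp only [mul_zero] at hg ⊢
    exact le_zero_iff.1 (v.map_sum_le fun i hi => (hg i hi).le)
  have hg0 {i} (hi : i ∈ s) (h0 : g i ≠ 0) : f i ≠ 0 := by
    rintro h
    exact h0 (v.zero_iff.1 (by rw [hg i hi, h, map_zero, zero_mul]))
  have hginj : Set.InjOn (fun i => v (g i)) {i | i ∈ s ∧ g i ≠ 0} := by
    rintro i ⟨hi, hi0⟩ j ⟨hj, hj0⟩ hij
    refine hf ⟨hi, hg0 hi hi0⟩ ⟨hj, hg0 hj hj0⟩ (mul_right_cancel₀ hγ ?_)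
    simpa only [hg i hi, hg j hj] using hij
  obtain ⟨i, hi, hfi, hmax⟩ := exists_valuation_sum_eq v hs hf
  obtain ⟨j, hj, hgj, hmax'⟩ := exists_valuation_sum_eq v hs hginj
  rw [hfi, hgj]
  refine le_antisymm (hg j hj ▸ ?_) (hg i hi ▸ hmax' i hi)
  gcongr
  exact hmax j hj

theorem valuation_one_add_pow_sub_linear_le {w : F} (hw : v w ≤ 1) (n : ℕ) :
    v ((1 + w) ^ n - 1 - n * w) ≤ v w ^ 2 := by
  induction n with
  | zero => simp
  | succ n ih =>
    have step : (1 + w) ^ (n + 1) - 1 - ((n + 1 : ℕ) : F) * w =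
        (1 + w) * ((1 + w) ^ n - 1 - n * w) + n * w ^ 2 := by push_cast; ring
    rw [step]
    refine v.map_add_le ?_ ((valuation_natCast_mul_le v n _).trans_eq (map_pow v w 2))
    rw [map_mul]
    exact (mul_le_of_le_one_left' (v.map_add_le v.map_one.le hw)).trans ih

theorem valuation_one_add_pow_sub_one_le {w : F} (hw : v w ≤ 1) (n : ℕ) :
    v ((1 + w) ^ n - 1) ≤ v w := by
  rw [← sub_add_cancel ((1 + w) ^ n - 1) (n * w)]
  refine v.map_add_le ((valuation_one_add_pow_sub_linear_le v hw n).trans ?_)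
    (valuation_natCast_mul_le v n w)
  exact pow_le_of_le_one zero_le hw two_ne_zero

theorem valuation_one_add_pow_sub_one {w : F} (hw : v w < 1) {n : ℕ} (hn : v n = 1) :
    v ((1 + w) ^ n - 1) = v w := by
  obtain rfl | h0 := eq_or_ne w 0
  · simp
  have hlin : v (n * w) = v w := by rw [map_mul, hn, one_mul]
  have hsq : v w ^ 2 < v w := pow_lt_self_of_lt_one₀ (v.pos_iff.2 h0) hw one_lt_two
  rw [← sub_add_cancel ((1 + w) ^ n - 1) (n * w), v.map_add_eq_of_lt_right, hlin]
  exact hlin ▸ (valuation_one_add_pow_sub_linear_le v hw.le n).trans_lt hsq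

theorem valuation_inv_sub_one {θ : F} (hθ : v θ = 1) : v (θ⁻¹ - 1) = v (θ - 1) := by
  have hθ0 : θ ≠ 0 := v.ne_zero_iff.1 (hθ ▸ one_ne_zero)
  rw [← v.map_neg, neg_sub, show 1 - θ⁻¹ = (θ - 1) / θ by rw [sub_div, div_self hθ0, one_div],
    map_div₀, hθ, div_one]

variable {p : ℕ} (hp : p.Prime)
include hp

theorem valuation_add_pow_prime_sub_le {x y : F} {M : Γ₀} (hx : v x ≤ M) (hy : v y ≤ M) :
    v ((x + y) ^ p - (x ^ p + y ^ p)) ≤ v p * M ^ p := by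
  rw [add_pow_prime_eq' hp x y, add_sub_cancel_left, map_mul]
  refine mul_le_mul_right (v.map_sum_le fun k hk => ?_) _
  rw [mul_comm]
  refine (valuation_natCast_mul_le v _ _).trans ?_
  rw [map_mul, map_pow, map_pow, ← Nat.add_sub_of_le (Finset.mem_Ioo.1 hk).2.le, pow_add M,
    Nat.add_sub_cancel_left]
  exact mul_le_mul' (pow_le_pow_left' hx _) (pow_le_pow_left' hy _)

theorem valuation_sum_pow_prime_sub_le {ι : Type*} (s : Finset ι) (f : ι → F) {M : Γ₀}
    (hf : ∀ i ∈ s, v (f i) ≤ M) :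
    v ((∑ i ∈ s, f i) ^ p - ∑ i ∈ s, f i ^ p) ≤ v p * M ^ p := by
  classical
  induction s using Finset.induction_on with
  | empty => simp [hp.ne_zero]
  | insert a s ha ih =>
    rw [Finset.forall_mem_insert] at hf
    rw [Finset.sum_insert ha, Finset.sum_insert ha,
      ← sub_add_sub_cancel _ (f a ^ p + (∑ i ∈ s, f i) ^ p), add_sub_add_left_eq_sub]
    exact v.map_add_le (valuation_add_pow_prime_sub_le v hp hf.1 (v.map_sum_le hf.2)) (ih hf.2)

theorem valuation_one_add_pow_prime_sub_le {z : F} (hz : v z ≤ 1) :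
    v ((1 + z) ^ p - (1 + p * z + z ^ p)) ≤ v p * v z ^ 2 := by
  have hI : Finset.Ioo 0 p = insert 1 (Finset.Ioo 1 p) :=
    (Finset.Ioo_insert_left hp.one_lt).symm
  have expand : (1 + z) ^ p - (1 + p * z + z ^ p) =
      p * ∑ k ∈ Finset.Ioo 1 p, z ^ k * ((p.choose k / p : ℕ) : F) := by
    rw [add_comm 1 z, add_pow_prime_eq' hp z 1, hI, Finset.sum_insert (by simp)]
    simp only [Nat.choose_one_right, Nat.div_self hp.pos, one_pow, mul_one, pow_one,
      Nat.cast_one]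
    ring
  rw [expand, map_mul]
  refine mul_le_mul_right (v.map_sum_le fun k hk => ?_) _
  rw [mul_comm]
  refine (valuation_natCast_mul_le v _ _).trans ?_
  rw [map_pow]
  exact pow_le_pow_right_of_le_one' hz (Finset.mem_Ioo.1 hk).1

theorem valuation_one_add_pow_prime_sub_sub {w : F} (hw : v w < 1) :
    v ((1 + w) ^ p - 1 - w ^ p) = v p * v w := by
  have hle := valuation_one_add_pow_prime_sub_le v hp hw.le
  obtain h0 | h0 := eq_or_ne ((p : F) * w) 0
  · have h0' : v p * v w = 0 := by rw [← map_mul, h0, map_zero]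
    rw [pow_two, ← mul_assoc, h0', zero_mul, le_zero_iff, v.zero_iff, h0, add_zero] at hle
    rw [sub_sub, hle, map_zero, h0']
  · have hlt : v p * v w ^ 2 < v (p * w) := by
      rw [pow_two, ← mul_assoc, ← map_mul]
      exact mul_lt_of_lt_one_right (v.pos_iff.2 h0) hw
    rw [show (1 + w) ^ p - 1 - w ^ p = ((1 + w) ^ p - (1 + p * w + w ^ p)) + p * w by ring,
      v.map_add_eq_of_lt_right (hle.trans_lt hlt), map_mul]

theorem valuation_one_sub_mul_one_add_pow_prime_sub_le {z : F} (hz : v z ≤ 1) :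
    v ((1 - p * z) * (1 + z) ^ p - (1 + z ^ p)) ≤ v p * v z ^ 2 := by
  have hpz : v (p * z) ≤ 1 := (valuation_natCast_mul_le v p z).trans hz
  rw [show (1 - p * z) * (1 + z) ^ p - (1 + z ^ p) = -(p * (p * z ^ 2)) - p * (z * z ^ p) +
    (1 - p * z) * ((1 + z) ^ p - (1 + p * z + z ^ p)) by ring]
  refine v.map_add_le (v.map_sub_le ?_ ?_) ?_
  · rw [v.map_neg, map_mul, ← map_pow]
    exact mul_le_mul_right (valuation_natCast_mul_le v p _) _
  · rw [map_mul, map_mul, map_pow, ← pow_succ']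
    exact mul_le_mul_right (pow_le_pow_right_of_le_one' hz (by linarith [hp.pos])) _
  · rw [map_mul]
    exact (mul_le_of_le_one_left' (v.map_sub_le v.map_one.le hpz)).trans
      (valuation_one_add_pow_prime_sub_le v hp hz)

end ValuationEstimates

section TotallyRamified

variable {K L Γ₀ : Type*} [Field K] [Field L] [Algebra K L] [LinearOrderedCommGroupWithZero Γ₀]

/-- `π` generates a totally ramified extension `L/K` of degree `n`: the values of `v` on `K` are
powers of `v π ^ n`. Only these values enter, so `π` need not generate the value group of `L`
a priori. -/
structure IsTotallyRamifiedGenerator (K : Type*) {L Γ₀ : Type*} [Field K] [Field L] [Algebra K L]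
    [LinearOrderedCommGroupWithZero Γ₀] (v : Valuation L Γ₀) (n : ℕ) (π : L) : Prop where
  pos : 0 < v π
  lt_one : v π < 1
  exists_zpow_eq : ∀ c : K, c ≠ 0 → ∃ k : ℤ, v (algebraMap K L c) = v π ^ (n * k)

namespace IsTotallyRamifiedGenerator

variable {v : Valuation L Γ₀} {n : ℕ} {π : L}

theorem of_valuation_eq {π' : L} (h : IsTotallyRamifiedGenerator K v n π) (hπ : v π' = v π) :
    IsTotallyRamifiedGenerator K v n π' :=
  ⟨hπ ▸ h.pos, hπ ▸ h.lt_one, hπ ▸ h.exists_zpow_eq⟩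

variable (h : IsTotallyRamifiedGenerator K v n π)
include h

theorem ne_zero : π ≠ 0 := v.pos_iff.1 h.pos

theorem exists_valuation_smul_pow_eq {c : K} (hc : c ≠ 0) (i : ℕ) :
    ∃ k : ℤ, v (c • π ^ i) = v π ^ (n * k + i) := by
  obtain ⟨k, hk⟩ := h.exists_zpow_eq c hc
  exact ⟨k, by rw [Algebra.smul_def, map_mul, map_pow, hk, zpow_add₀ h.pos.ne', zpow_natCast]⟩

theorem injOn_valuation_smul_pow (c : Fin n → K) :
    Set.InjOn (fun i : Fin n => v (c i • π ^ (i : ℕ))) {i | c i • π ^ (i : ℕ) ≠ 0} := by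
  intro i hi j hj hij
  obtain ⟨k, hk⟩ := h.exists_valuation_smul_pow_eq (left_ne_zero_of_smul hi) i
  obtain ⟨l, hl⟩ := h.exists_valuation_smul_pow_eq (left_ne_zero_of_smul hj) j
  have hexp : (n * k + i : ℤ) = n * l + j :=
    zpow_right_injective₀ h.pos h.lt_one.ne (hk.symm.trans (hij.trans hl))
  have hmod : (i : ℤ) % n = (j : ℤ) % n := by
    simpa only [Int.mul_add_emod_self_left] using congrArg (· % (n : ℤ)) hexp
  rw [Int.emod_eq_of_lt (by lia) (by lia), Int.emod_eq_of_lt (by lia) (by lia)] at hmod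
  exact Fin.ext (by exact_mod_cast hmod)

theorem valuation_smul_pow_le (c : Fin n → K) (i : Fin n) :
    v (c i • π ^ (i : ℕ)) ≤ v (∑ j, c j • π ^ (j : ℕ)) :=
  valuation_le_valuation_sum v ((h.injOn_valuation_smul_pow c).mono fun _ hi => hi.2)
    (Finset.mem_univ i)

theorem linearIndependent_pow : LinearIndependent K fun i : Fin n => π ^ (i : ℕ) := by
  rw [Fintype.linearIndependent_iff]
  intro c hc i
  have hi := h.valuation_smul_pow_le c i
  rw [hc, map_zero, le_zero_iff, v.zero_iff, smul_eq_zero] at hi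
  exact hi.resolve_right (pow_ne_zero _ h.ne_zero)

variable [NeZero n]

/-- The basis `1, π, …, π ^ (n - 1)` of a totally ramified extension of degree `n`. -/
def powBasis (hdeg : Module.finrank K L = n) : Module.Basis (Fin n) K L :=
  basisOfLinearIndependentOfCardEqFinrank h.linearIndependent_pow (by simp [hdeg])

theorem powBasis_apply (hdeg : Module.finrank K L = n) (i : Fin n) :
    h.powBasis hdeg i = π ^ (i : ℕ) := by
  simp [powBasis]

theorem exists_eq_sum_smul_pow (hdeg : Module.finrank K L = n) (x : L) :
    ∃ c : Fin n → K, x = ∑ i, c i • π ^ (i : ℕ) := by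
  refine ⟨(h.powBasis hdeg).repr x, ?_⟩
  simpa only [powBasis_apply] using ((h.powBasis hdeg).sum_repr x).symm

theorem adjoin_eq_top (hdeg : Module.finrank K L = n) : IntermediateField.adjoin K {π} = ⊤ := by
  refine eq_top_iff.2 fun x _ => ?_
  obtain ⟨c, rfl⟩ := h.exists_eq_sum_smul_pow hdeg x
  exact sum_mem fun i _ => IntermediateField.smul_mem _
    (pow_mem (IntermediateField.mem_adjoin_simple_self K π) _)

end IsTotallyRamifiedGenerator

/-- `π ^ p` lies in `K` up to a factor `1 + y` with `|y| ≤ |p| δ`: the quality of an approximate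
solution in the Newton iteration producing a `p`-th root of an element of `K`. -/
def IsApproximateRoot (K : Type*) {L Γ₀ : Type*} [Field K] [Field L] [Algebra K L]
    [LinearOrderedCommGroupWithZero Γ₀] (v : Valuation L Γ₀) (p : ℕ) (δ : Γ₀) (π : L) : Prop :=
  ∃ (a : K) (y : L), π ^ p = algebraMap K L a * (1 + y) ∧ v y ≤ v p * δ

namespace IsTotallyRamifiedGenerator

variable {v : Valuation L Γ₀} {p : ℕ} {π : L} (h : IsTotallyRamifiedGenerator K v p π)
  (hp : p.Prime) (hdeg : Module.finrank K L = p)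
include h hp hdeg

theorem exists_valuation_pow_prime_sub_le {a : K} {y : L}
    (ha : π ^ p = algebraMap K L a * (1 + y)) {δ : Γ₀} (hδ : δ < 1) (hy : v y ≤ v p * δ) {z : L}
    (hz : v z ≤ δ) : ∃ u : K, v (z ^ p - algebraMap K L u) ≤ v p * δ ^ 2 := by
  have : NeZero p := ⟨hp.ne_zero⟩
  have hδp : δ ^ p ≤ δ ^ 2 := pow_le_pow_right_of_le_one' hδ.le hp.two_le
  have hy1 : v y < 1 :=
    (hy.trans (mul_le_of_le_one_left' (valuation_natCast_le_one v p))).trans_lt hδ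
  obtain ⟨c, rfl⟩ := h.exists_eq_sum_smul_pow hdeg z
  have hc (i : Fin p) : v (c i • π ^ (i : ℕ)) ≤ δ := (h.valuation_smul_pow_le c i).trans hz
  have hpow (i : Fin p) : (c i • π ^ (i : ℕ)) ^ p =
      algebraMap K L (c i ^ p * a ^ (i : ℕ)) * (1 + y) ^ (i : ℕ) := by
    rw [Algebra.smul_def, mul_pow, ← pow_mul, mul_comm (i : ℕ) p, pow_mul, ha, mul_pow]
    simp only [map_mul, map_pow, mul_assoc]
  have hterm (i : Fin p) :
      v ((c i • π ^ (i : ℕ)) ^ p - algebraMap K L (c i ^ p * a ^ (i : ℕ))) ≤ v p * δ ^ 2 := by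
    have hval : v (algebraMap K L (c i ^ p * a ^ (i : ℕ))) = v (c i • π ^ (i : ℕ)) ^ p := by
      rw [← map_pow v, hpow, v.map_mul, map_pow v (1 + y), v.map_one_add_of_lt hy1, one_pow,
        mul_one]
    rw [hpow, ← mul_sub_one, map_mul, hval]
    calc v (c i • π ^ (i : ℕ)) ^ p * v ((1 + y) ^ (i : ℕ) - 1)
        ≤ δ ^ 2 * (v p * δ) := mul_le_mul' ((pow_le_pow_left' (hc i) p).trans hδp)
          ((valuation_one_add_pow_sub_one_le v hy1.le _).trans hy)
      _ = v p * δ ^ 2 * δ := by ac_rfl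
      _ ≤ v p * δ ^ 2 := mul_le_of_le_one_right' hδ.le
  refine ⟨∑ i, c i ^ p * a ^ (i : ℕ), ?_⟩
  rw [map_sum, ← sub_add_sub_cancel _ (∑ i, (c i • π ^ (i : ℕ)) ^ p), ← Finset.sum_sub_distrib]
  refine v.map_add_le ?_ (v.map_sum_le fun i _ => hterm i)
  exact (valuation_sum_pow_prime_sub_le v hp _ _ fun i _ => hc i).trans (mul_le_mul_right hδp _)

/-- One Newton step: `z = -y / p` cancels the linear term of `(1 + y) (1 + z) ^ p`, and the
remaining `z ^ p` is absorbed into `K` because it is additive modulo `p`. -/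
theorem exists_isApproximateRoot_sq (hpL : (p : L) ≠ 0) {δ : Γ₀} (hδ : δ < 1)
    (hπ : IsApproximateRoot K v p δ π) :
    ∃ π', v π' = v π ∧ IsApproximateRoot K v p (δ ^ 2) π' := by
  obtain ⟨a, y, ha, hy⟩ := hπ
  obtain ⟨z, rfl⟩ : ∃ z, y = -(p * z) := ⟨-y / p, by field_simp⟩
  have hz : v z ≤ δ := by
    rw [v.map_neg, map_mul] at hy
    exact (mul_le_mul_iff_right₀ (v.pos_iff.2 hpL)).1 hy
  obtain ⟨u, hu⟩ := h.exists_valuation_pow_prime_sub_le hp hdeg ha hδ hy hz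
  have hz1 : v z < 1 := hz.trans_lt hδ
  have hsmall : v p * δ ^ 2 < 1 :=
    (mul_le_of_le_one_left' (valuation_natCast_le_one v p)).trans_lt
      (pow_lt_one₀ zero_le hδ two_ne_zero)
  have hu1 : v (algebraMap K L u) < 1 := by
    rw [← sub_sub_cancel (z ^ p) (algebraMap K L u)]
    exact v.map_sub_lt ((map_pow v z p).trans_lt (pow_lt_one₀ zero_le hz1 hp.ne_zero))
      (hu.trans_lt hsmall)
  have hvu : v (1 + algebraMap K L u) = 1 := v.map_one_add_of_lt hu1
  have hu0 : 1 + algebraMap K L u ≠ 0 := v.ne_zero_iff.1 (hvu ▸ one_ne_zero)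
  set e := (1 - p * z) * (1 + z) ^ p - (1 + algebraMap K L u) with he
  have hve : v e ≤ v p * δ ^ 2 := by
    rw [he, ← sub_add_sub_cancel _ (1 + z ^ p), add_sub_add_left_eq_sub]
    refine v.map_add_le ((valuation_one_sub_mul_one_add_pow_prime_sub_le v hp hz1.le).trans ?_) hu
    gcongr
  refine ⟨π * (1 + z), ?_, a * (1 + u), e / (1 + algebraMap K L u), ?_, ?_⟩
  · rw [map_mul, v.map_one_add_of_lt hz1, mul_one]
  · rw [mul_pow, ha, map_mul, map_add, map_one]
    field_simp
    rw [he]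
    ring
  · rwa [map_div₀, hvu, div_one]

theorem exists_isApproximateRoot_pow (hpL : (p : L) ≠ 0) {δ : Γ₀} (hδ : δ < 1)
    (hπ : IsApproximateRoot K v p δ π) (m : ℕ) :
    ∃ π', v π' = v π ∧ IsApproximateRoot K v p (δ ^ 2 ^ m) π' := by
  induction m with
  | zero => exact ⟨π, rfl, by simpa using hπ⟩
  | succ m ih =>
    obtain ⟨π₁, hv₁, hπ₁⟩ := ih
    obtain ⟨π₂, hv₂, hπ₂⟩ := (h.of_valuation_eq hv₁).exists_isApproximateRoot_sq hp hdeg hpL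
      (pow_lt_one₀ zero_le hδ (by positivity)) hπ₁
    exact ⟨π₂, hv₂.trans hv₁, by rwa [pow_succ 2, pow_mul]⟩

end IsTotallyRamifiedGenerator

theorem IsApproximateRoot.exists_pow_eq_algebraMap {v : Valuation L Γ₀} {p : ℕ} {π : L} {δ : Γ₀}
    (hπ : IsApproximateRoot K v p δ π) (hp : p ≠ 0)
    (hroot : ∀ y : L, v y ≤ v p * δ → v y < 1 ∧ ∃ s : L, s ^ p = 1 + y) :
    ∃ (α : L) (a : K), v α = v π ∧ α ^ p = algebraMap K L a := by
  obtain ⟨a, y, ha, hy⟩ := hπ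
  obtain ⟨hy1, s, hs⟩ := hroot y hy
  have hvs : v s = 1 := by
    rw [← pow_eq_one_iff_of_nonneg zero_le hp, ← map_pow, hs, v.map_one_add_of_lt hy1]
  have hs0 : s ≠ 0 := v.ne_zero_iff.1 (hvs ▸ one_ne_zero)
  exact ⟨π / s, a, by rw [map_div₀, hvs, div_one], by rw [div_pow, ha, ← hs]; field_simp⟩

end TotallyRamified

section Displacement

theorem IsTotallyRamifiedGenerator.isApproximateRoot_of_valuation_sub_le {K L Γ₀ : Type*} [Field K]
    [Field L] [Algebra K L] [LinearOrderedCommGroupWithZero Γ₀] {v : Valuation L Γ₀} {π : L} {p : ℕ}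
    (h : IsTotallyRamifiedGenerator K v p π) {c : K}
    (hc : v (π ^ p - algebraMap K L c) ≤ v p * v π ^ (p + 1)) :
    IsApproximateRoot K v p (v π) π := by
  have hlt : v (π ^ p - algebraMap K L c) < v (π ^ p) := by
    refine (hc.trans (mul_le_of_le_one_left' (valuation_natCast_le_one v p))).trans_lt ?_
    rw [map_pow]
    exact pow_lt_pow_right_of_lt_one₀ h.pos h.lt_one p.lt_succ_self
  have hvc : v (algebraMap K L c) = v π ^ p := by
    rw [← sub_sub_cancel (π ^ p) (algebraMap K L c), v.map_sub_eq_of_lt_left hlt, map_pow]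
  have hc0 : algebraMap K L c ≠ 0 := v.pos_iff.1 (hvc ▸ pow_pos h.pos p)
  refine ⟨c, (π ^ p - algebraMap K L c) / algebraMap K L c, by field_simp; ring, ?_⟩
  rw [map_div₀, hvc]
  refine div_le_of_le_mul₀ zero_le zero_le (hc.trans_eq ?_)
  rw [pow_succ']
  ac_rfl

variable {K L E Γ₀ : Type*} [Field K] [Field L] [Algebra K L] [Field E] [Algebra K E] [Algebra L E]
  [IsScalarTower K L E] [LinearOrderedCommGroupWithZero Γ₀] {V : Valuation E Γ₀}

/-- `(1 + w) ^ p - 1` is `w ^ p` plus a term of value `|p w|`, and the congruences modulo `p`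
prevent `w ^ p` from dominating. -/
theorem valuation_one_add_pow_prime_sub_one_le {p : ℕ} (hp : p.Prime) {w : E} (hw : V w < 1)
    {γ : Γ₀} (hγ0 : 0 < γ) (hγ1 : γ < 1) {R T : ℕ} (hR : ¬ p ∣ R) (hT : p ∣ T)
    (hwT : V w = γ ^ T) {m : ℤ} (hm : ¬ (p : ℤ) ∣ m)
    (hval : (γ ^ R) ^ p * V ((1 + w) ^ p - 1) = (γ ^ R) ^ m * V w) :
    V ((1 + w) ^ p - 1) ≤ V p * V w := by
  have hlin := valuation_one_add_pow_prime_sub_sub V hp hw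
  rw [← sub_add_cancel ((1 + w) ^ p - 1) (w ^ p)]
  refine V.map_add_le hlin.le (le_of_not_gt fun hlt => hm ?_)
  have hdom : V ((1 + w) ^ p - 1) = V w ^ p := by
    rw [← sub_add_cancel ((1 + w) ^ p - 1) (w ^ p),
      V.map_add_eq_of_lt_right (hlin.trans_lt hlt), map_pow]
  rw [hdom, hwT] at hval
  simp only [← zpow_natCast, ← zpow_mul, ← zpow_add₀ hγ0.ne'] at hval
  have hexp : (R * p + T * p : ℤ) = R * m + T := zpow_right_injective₀ hγ0 hγ1.ne hval
  have hRm : (p : ℤ) ∣ R * m := by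
    rw [← Int.dvd_add_left (Int.natCast_dvd_natCast.2 hT), ← hexp, ← add_mul]
    exact dvd_mul_left _ _
  exact ((Nat.prime_iff_prime_int.1 hp).dvd_or_dvd hRm).resolve_left
    (mt Int.natCast_dvd_natCast.1 hR)

theorem zpow_le_zpow_mul_pow_succ_of_not_dvd {ρ : Γ₀} (hρ0 : 0 < ρ) (hρ1 : ρ < 1) {n : ℕ} {k m : ℤ}
    (hm : ¬ (n : ℤ) ∣ m) (hle : ρ ^ m ≤ ρ ^ (n * k) * ρ ^ n) :
    ρ ^ m ≤ ρ ^ (n * k) * ρ ^ (n + 1) := by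
  rw [← zpow_natCast, ← zpow_add₀ hρ0.ne'] at hle ⊢
  rw [zpow_le_zpow_iff_right_of_lt_one₀ hρ0 hρ1] at hle ⊢
  have hne : n * k + n ≠ m := fun h => hm ⟨k + 1, by rw [← h, mul_add_one]⟩
  push_cast
  lia

variable {v : Valuation L Γ₀} (hV : ∀ x, V (algebraMap L E x) = v x) {π : L}
  (σ : E →ₐ[K] E) {w : E} (hw : V w < 1) (hσ : σ (algebraMap L E π) = algebraMap L E π * (1 + w))

include hσ in
theorem map_sum_smul_pow_sub {n : ℕ} [NeZero n] (c : Fin n → K) :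
    σ (algebraMap L E (∑ i, c i • π ^ (i : ℕ))) - algebraMap L E (∑ i, c i • π ^ (i : ℕ)) =
      ∑ i ∈ Finset.univ.erase (0 : Fin n),
        algebraMap L E (c i • π ^ (i : ℕ)) * ((1 + w) ^ (i : ℕ) - 1) := by
  have hterm (i : Fin n) : σ (algebraMap L E (c i • π ^ (i : ℕ))) -
      algebraMap L E (c i • π ^ (i : ℕ)) =
      algebraMap L E (c i • π ^ (i : ℕ)) * ((1 + w) ^ (i : ℕ) - 1) := by
    rw [Algebra.smul_def, map_mul, map_mul, ← IsScalarTower.algebraMap_apply, AlgHom.commutes,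
      map_pow, map_pow, hσ, mul_pow, mul_sub_one, mul_assoc]
  rw [map_sum, map_sum, ← Finset.sum_sub_distrib, ← Finset.add_sum_erase _ _ (Finset.mem_univ 0)]
  simp only [hterm]
  rw [Fin.val_zero, pow_zero, pow_zero, sub_self, mul_zero, zero_add]

include hV hw hσ

/-- For `x = ∑ cᵢ π ^ i` the displacement `σ x - x = ∑ cᵢ π ^ i ((1 + w) ^ i - 1)` loses the
constant term and multiplies the values of all others, which are distinct, by `|w|`. -/
theorem IsTotallyRamifiedGenerator.exists_valuation_map_sub_eq {n : ℕ} [NeZero n]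
    (h : IsTotallyRamifiedGenerator K v n π) (hdeg : Module.finrank K L = n)
    (hunit : ∀ i : ℕ, 0 < i → i < n → V i = 1) (x : L) :
    ∃ c : K, V (σ (algebraMap L E x) - algebraMap L E x) = v (x - algebraMap K L c) * V w ∧
      (x = algebraMap K L c ∨ ∃ m : ℤ, ¬ (n : ℤ) ∣ m ∧ v (x - algebraMap K L c) = v π ^ m) := by
  obtain ⟨c, rfl⟩ := h.exists_eq_sum_smul_pow hdeg x
  set f : Fin n → L := fun i => c i • π ^ (i : ℕ) with hf
  have hsub : ∑ i, f i - algebraMap K L (c 0) = ∑ i ∈ Finset.univ.erase (0 : Fin n), f i := by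
    rw [← Finset.add_sum_erase _ _ (Finset.mem_univ 0), sub_eq_iff_eq_add', hf]
    simp [Algebra.smul_def]
  have hinj : Set.InjOn (fun i => v (f i)) {i | i ∈ Finset.univ.erase (0 : Fin n) ∧ f i ≠ 0} :=
    (h.injOn_valuation_smul_pow c).mono fun _ hi => hi.2
  refine ⟨c 0, ?_, ?_⟩
  · rw [map_sum_smul_pow_sub σ hσ c, hsub, ← hV, map_sum (algebraMap L E)]
    refine valuation_sum_eq_mul V (f := fun i => algebraMap L E (f i))
      (by simpa only [hV, ne_eq, map_eq_zero] using hinj) fun i hi => ?_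
    rw [map_mul, valuation_one_add_pow_sub_one V hw (hunit i ?_ i.2)]
    exact Nat.pos_of_ne_zero fun h0 => Finset.ne_of_mem_erase hi (Fin.ext h0)
  rw [← sub_eq_zero, hsub]
  refine or_iff_not_imp_left.2 fun hne => ?_
  obtain ⟨i, hi, hvi, -⟩ := exists_valuation_sum_eq v (Finset.nonempty_of_sum_ne_zero hne) hinj
  have hfi : f i ≠ 0 := v.ne_zero_iff.1 (hvi ▸ v.ne_zero_iff.2 hne)
  obtain ⟨k, hk⟩ := h.exists_valuation_smul_pow_eq (left_ne_zero_of_smul hfi) i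
  refine ⟨n * k + i, fun hdvd => ?_, hvi.trans hk⟩
  rw [Int.dvd_add_right (dvd_mul_right _ _), Int.natCast_dvd_natCast] at hdvd
  exact Finset.ne_of_mem_erase hi (Fin.ext (Nat.eq_zero_of_dvd_of_lt hdvd i.2))

theorem IsTotallyRamifiedGenerator.isApproximateRoot {p : ℕ} (hp : p.Prime)
    (h : IsTotallyRamifiedGenerator K v p π) (hdeg : Module.finrank K L = p) (hpK : (p : K) ≠ 0)
    (hunit : ∀ i : ℕ, 0 < i → i < p → V i = 1) {γ : Γ₀} (hγ0 : 0 < γ) (hγ1 : γ < 1)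
    {R T : ℕ} (hR : ¬ p ∣ R) (hπ : v π = γ ^ R) (hT : p ∣ T) (hwT : V w = γ ^ T) :
    IsApproximateRoot K v p (v π) π := by
  have : NeZero p := ⟨hp.ne_zero⟩
  obtain ⟨c, hdisp, hc | ⟨m, hm, hvm⟩⟩ :=
    h.exists_valuation_map_sub_eq hV σ hw hσ hdeg hunit (π ^ p)
  · exact ⟨c, 0, by rw [hc, add_zero, mul_one], by simp⟩
  obtain ⟨k, hk⟩ := h.exists_zpow_eq _ hpK
  rw [map_natCast] at hk
  have hVp : V (p : E) = v p := by rw [← hV, map_natCast (algebraMap L E)]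
  rw [map_pow, map_pow, hσ, mul_pow, ← mul_sub_one, map_mul, map_pow, hV, hvm] at hdisp
  have hbound : V ((1 + w) ^ p - 1) ≤ v p * V w :=
    hVp ▸ valuation_one_add_pow_prime_sub_one_le hp hw hγ0 hγ1 hR hT hwT hm (hπ ▸ hdisp)
  have hle : v π ^ m ≤ v p * v π ^ p := by
    rw [← mul_le_mul_iff_left₀ (hwT ▸ pow_pos hγ0 T : 0 < V w), ← hdisp, mul_right_comm, mul_comm]
    exact mul_le_mul_left hbound _
  refine h.isApproximateRoot_of_valuation_sub_le (c := c) ?_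
  rw [hk] at hle ⊢
  exact hvm ▸ zpow_le_zpow_mul_pow_succ_of_not_dvd h.pos h.lt_one hm hle

end Displacement

section PadicValuation

variable (p : ℕ) [Fact p.Prime]

/-- The absolute value of an algebraic extension of `ℚ_[p]` extending the one of `ℚ_[p]`. -/
def padicVal (F : Type*) [Field F] [Algebra ℚ_[p] F] [Algebra.IsAlgebraic ℚ_[p] F] :
    Valuation F ℝ≥0 where
  toFun x := ⟨spectralNorm ℚ_[p] F x, spectralNorm_nonneg x⟩
  map_zero' := Subtype.ext spectralNorm_zero
  map_one' := Subtype.ext spectralNorm_one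
  map_mul' x y := Subtype.ext ((spectralMulAlgNorm ℚ_[p] F).map_mul' x y)
  map_add_le_max' x y := isNonarchimedean_spectralNorm x y

section Algebraic

variable {F : Type*} [Field F] [Algebra ℚ_[p] F] [Algebra.IsAlgebraic ℚ_[p] F]

theorem coe_padicVal (x : F) : (padicVal p F x : ℝ) = spectralNorm ℚ_[p] F x := rfl

theorem padicVal_map {F' : Type*} [Field F'] [Algebra ℚ_[p] F'] [Algebra.IsAlgebraic ℚ_[p] F']
    (f : F →ₐ[ℚ_[p]] F') (x : F) : padicVal p F' (f x) = padicVal p F x := by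
  refine NNReal.eq ?_
  rw [coe_padicVal, coe_padicVal, spectralNorm, spectralNorm, minpoly.algHom_eq f f.injective]

theorem coe_padicVal_natCast (n : ℕ) : (padicVal p F n : ℝ) = ‖(n : ℚ_[p])‖ := by
  rw [← map_natCast (algebraMap ℚ_[p] F), coe_padicVal, spectralNorm_extends]

theorem padicVal_prime_lt_one : padicVal p F p < 1 := by
  rw [← NNReal.coe_lt_coe, coe_padicVal_natCast]
  exact Padic.norm_p_lt_one

theorem padicVal_natCast_eq_one {n : ℕ} (hn : ¬ p ∣ n) : padicVal p F n = 1 := by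
  rw [← NNReal.coe_inj, coe_padicVal_natCast]
  exact Padic.norm_natCast_eq_one_iff.2 ((Nat.Prime.coprime_iff_not_dvd Fact.out).2 hn)

theorem padicVal_le_one_iff {x : F} : padicVal p F x ≤ 1 ↔ x ∈ ringOfIntegers p F := by
  let : Algebra ℤ_[p] F := Algebra.compHom F (algebraMap ℤ_[p] ℚ_[p])
  have : IsScalarTower ℤ_[p] ℚ_[p] F := IsScalarTower.of_algebraMap_eq fun _ => rfl
  have hx : IsIntegral ℚ_[p] x := Algebra.IsIntegral.isIntegral x
  have hcoeff : padicVal p F x ≤ 1 ↔ ∀ n, ‖(minpoly ℚ_[p] x).coeff n‖ ≤ 1 := by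
    rw [← spectralValue_le_one_iff (minpoly.monic hx), ← NNReal.coe_le_coe]
    rfl
  have hmem : x ∈ ringOfIntegers p F ↔ IsIntegral ℤ_[p] x := Iff.rfl
  rw [hcoeff, hmem]
  refine ⟨fun h => ?_, fun h n => ?_⟩
  · have hlifts : minpoly ℚ_[p] x ∈ Polynomial.lifts (algebraMap ℤ_[p] ℚ_[p]) :=
      (Polynomial.lifts_iff_coeff_lifts _).2 fun n => ⟨⟨_, h n⟩, rfl⟩
    obtain ⟨q, hq, -, hmonic⟩ :=
      Polynomial.lifts_and_degree_eq_and_monic hlifts (minpoly.monic hx)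
    refine ⟨q, hmonic, ?_⟩
    rw [← Polynomial.aeval_def, ← Polynomial.aeval_map_algebraMap ℚ_[p], hq, minpoly.aeval]
  · rw [minpoly.isIntegrallyClosed_eq_field_fractions' ℚ_[p] h, Polynomial.coeff_map]
    exact PadicInt.norm_le_one _

theorem integers_padicVal : (padicVal p F).Integers (ringOfIntegers p F) where
  hom_inj := Subtype.val_injective
  map_le_one x := (padicVal_le_one_iff p).2 x.2
  exists_of_le_one x hx := ⟨⟨x, (padicVal_le_one_iff p).1 hx⟩, rfl⟩

instance valuationRing_ringOfIntegers : ValuationRing (ringOfIntegers p F) :=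
  ValuationRing.of_integers (padicVal p F) (integers_padicVal p)

end Algebraic

variable {F : Type*} [Field F] [Algebra ℚ_[p] F] [FiniteDimensional ℚ_[p] F]

instance isDiscreteValuationRing_ringOfIntegers :
    IsDiscreteValuationRing (ringOfIntegers p F) := by
  let : Algebra ℤ_[p] F := Algebra.compHom F (algebraMap ℤ_[p] ℚ_[p])
  have : IsScalarTower ℤ_[p] ℚ_[p] F := IsScalarTower.of_algebraMap_eq fun _ => rfl
  have : IsNoetherianRing (ringOfIntegers p F) :=
    IsIntegralClosure.isNoetherianRing ℤ_[p] ℚ_[p] F (integralClosure ℤ_[p] F)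
  have : CharZero F := charZero_of_injective_algebraMap (algebraMap ℚ_[p] F).injective
  have hfield : ¬ IsField (ringOfIntegers p F) := fun h => by
    have hp0 : (p : ringOfIntegers p F) ≠ 0 := Nat.cast_ne_zero.2 (Fact.out : p.Prime).ne_zero
    obtain ⟨b, hb⟩ := h.mul_inv_cancel hp0
    have hunit := (integers_padicVal p).one_of_isUnit (.of_mul_eq_one b hb)
    rw [map_natCast] at hunit
    exact (padicVal_prime_lt_one p).ne hunit
  exact ((IsDiscreteValuationRing.TFAE _ hfield).out 0 1).2 (valuationRing_ringOfIntegers p)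

instance finite_residueField_ringOfIntegers :
    Finite (IsLocalRing.ResidueField (ringOfIntegers p F)) := by
  let : Algebra ℤ_[p] F := Algebra.compHom F (algebraMap ℤ_[p] ℚ_[p])
  have : IsScalarTower ℤ_[p] ℚ_[p] F := IsScalarTower.of_algebraMap_eq fun _ => rfl
  have : IsLocalRing (integralClosure ℤ_[p] F) :=
    (inferInstance : IsLocalRing (ringOfIntegers p F))
  have : Module.Finite ℤ_[p] (integralClosure ℤ_[p] F) :=
    IsIntegralClosure.finite ℤ_[p] ℚ_[p] F (integralClosure ℤ_[p] F)
  have : FaithfulSMul ℤ_[p] F := .trans ℤ_[p] ℚ_[p] F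
  have : IsLocalHom (algebraMap ℤ_[p] (integralClosure ℤ_[p] F)) :=
    (algebraMap_isIntegral_iff.2 inferInstance).isLocalHom
      (FaithfulSMul.algebraMap_injective _ _)
  exact IsLocalRing.ResidueField.finite_of_finite (R := ℤ_[p]) (S := integralClosure ℤ_[p] F)
    (Finite.of_equiv _ (PadicInt.residueField (p := p)).symm.toEquiv)

theorem exists_natCast_pow_sub :
    ∃ q : ℕ, padicVal p F q < 1 ∧
      ∀ x : F, padicVal p F x ≤ 1 → padicVal p F (x ^ q - x) < 1 := by
  have := Fintype.ofFinite (IsLocalRing.ResidueField (ringOfIntegers p F))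
  have hlt {x : ringOfIntegers p F} (hx : IsLocalRing.residue _ x = 0) :
      padicVal p F x < 1 := by
    rw [IsLocalRing.residue_eq_zero_iff, IsLocalRing.mem_maximalIdeal, mem_nonunits_iff,
      (integers_padicVal p).isUnit_iff_valuation_eq_one] at hx
    exact ((integers_padicVal p).map_le_one x).lt_of_ne hx
  set q := Fintype.card (IsLocalRing.ResidueField (ringOfIntegers p F)) with hq
  refine ⟨q, ?_, fun x hx => ?_⟩
  · have hq0 : IsLocalRing.residue (ringOfIntegers p F) q = 0 := by
      rw [map_natCast, hq, FiniteField.cast_card_eq_zero]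
    simpa using hlt hq0
  · lift x to ringOfIntegers p F using (padicVal_le_one_iff p).1 hx
    have hres : IsLocalRing.residue _ (x ^ q - x) = 0 := by
      rw [map_sub, map_pow, hq, FiniteField.pow_card, sub_self]
    simpa using hlt hres

theorem exists_pow_prime_eq_one_add :
    ∃ ε : ℝ≥0, 0 < ε ∧ ∀ y : F, padicVal p F y < ε → ∃ s : F, s ^ p = 1 + y := by
  let := spectralNorm.nontriviallyNormedField ℚ_[p] F
  have : CompleteSpace F := spectralNorm.completeSpace ℚ_[p] F
  have : CharZero F := charZero_of_injective_algebraMap (algebraMap ℚ_[p] F).injective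
  have hopen : Filter.map (fun x : F => x ^ p) (nhds 1) = nhds (1 ^ p) :=
    (hasStrictDerivAt_pow p (1 : F)).map_nhds_eq (by simpa using (Fact.out : p.Prime).ne_zero)
  have hrange : Set.range (fun x : F => x ^ p) ∈ nhds (1 : F) := by
    rw [← one_pow p, ← hopen]
    exact Filter.range_mem_map
  obtain ⟨ε, hε, hball⟩ := Metric.mem_nhds_iff.1 hrange
  refine ⟨⟨ε, hε.le⟩, hε, fun y hy => hball ?_⟩
  rw [mem_ball_iff_norm, add_sub_cancel_left]
  exact hy

variable {p} {ϖ : ringOfIntegers p F} (hϖ : Irreducible ϖ)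
include hϖ

theorem padicVal_irreducible_pos : 0 < padicVal p F ϖ :=
  (integers_padicVal p).valuation_irreducible_pos hϖ

theorem padicVal_irreducible_lt_one : padicVal p F ϖ < 1 :=
  (integers_padicVal p).valuation_irreducible_lt_one hϖ

theorem exists_padicVal_eq_pow {x : F} (hx : x ∈ ringOfIntegers p F) (hx0 : x ≠ 0) :
    ∃ n : ℕ, padicVal p F x = padicVal p F ϖ ^ n := by
  lift x to ringOfIntegers p F using hx
  obtain ⟨n, u, rfl⟩ := IsDiscreteValuationRing.eq_unit_mul_pow_irreducible
    (fun h => hx0 (congrArg Subtype.val h)) hϖ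
  refine ⟨n, ?_⟩
  have hu := (integers_padicVal p).valuation_unit u
  push_cast
  rw [map_mul, map_pow]
  exact mul_eq_right₀ (pow_pos (padicVal_irreducible_pos hϖ) n).ne' |>.2 hu

theorem exists_padicVal_eq_zpow {x : F} (hx0 : x ≠ 0) :
    ∃ n : ℤ, padicVal p F x = padicVal p F ϖ ^ n := by
  rcases le_total (padicVal p F x) 1 with hx | hx
  · obtain ⟨n, hn⟩ := exists_padicVal_eq_pow hϖ ((padicVal_le_one_iff p).1 hx) hx0
    exact ⟨n, by rw [hn, zpow_natCast]⟩
  · obtain ⟨n, hn⟩ := exists_padicVal_eq_pow hϖ (x := x⁻¹)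
      ((padicVal_le_one_iff p).1 (by rw [map_inv₀]; exact inv_le_one_of_one_le₀ hx))
      (inv_ne_zero hx0)
    exact ⟨-n, by rw [zpow_neg, zpow_natCast, ← hn, map_inv₀, inv_inv]⟩

theorem padicVal_lt_one_iff_le {x : F} : padicVal p F x < 1 ↔ padicVal p F x ≤ padicVal p F ϖ := by
  refine ⟨fun hx => ?_, fun hx => hx.trans_lt (padicVal_irreducible_lt_one hϖ)⟩
  rcases eq_or_ne x 0 with rfl | hx0
  · simp
  obtain ⟨n, hn⟩ := exists_padicVal_eq_pow hϖ ((padicVal_le_one_iff p).1 hx.le) hx0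
  rw [hn] at hx ⊢
  exact pow_le_of_le_one zero_le (padicVal_irreducible_lt_one hϖ).le
    (by rintro rfl; exact absurd hx (by simp))

theorem mem_primeIdeal_pow_iff {n : ℕ} {x : ringOfIntegers p F} :
    x ∈ primeIdeal p F ^ n ↔ padicVal p F x ≤ padicVal p F ϖ ^ n := by
  have hideal : primeIdeal p F = Ideal.span {ϖ} := by
    rw [← hϖ.maximalIdeal_eq]
    exact IsLocalRing.jacobson_eq_maximalIdeal ⊥ bot_ne_top
  rw [hideal, Ideal.span_singleton_pow, Ideal.mem_span_singleton,
    (integers_padicVal p).dvd_iff_le, map_pow, map_pow]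
  rfl

end PadicValuation

section PrimePeriodic

theorem eq_id_of_iterate_prime_eq_id {X : Type*} [Finite X] {p : ℕ} [Fact p.Prime] {f : X → X}
    (hf : f^[p] = id) (hcard : Nat.card X ≤ p) {x₀ : X} (hx₀ : f x₀ = x₀) : f = id := by
  classical
  have := Fintype.ofFinite X
  have hmod : Nat.card X ≡ Nat.card (Function.fixedPoints f) [MOD p] := by
    rw [Nat.card_eq_fintype_card, Nat.card_eq_fintype_card]
    refine Equiv.Perm.card_fixedPoints_modEq (n := 1) (f := (f : Function.End X)) ?_
    rw [pow_one]
    exact hf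
  have hpos : 0 < Nat.card (Function.fixedPoints f) :=
    Nat.card_pos_iff.2 ⟨⟨x₀, hx₀⟩, inferInstance⟩
  have hle : Nat.card (Function.fixedPoints f) ≤ Nat.card X := Finite.card_subtype_le _
  have heq : Nat.card X = Nat.card (Function.fixedPoints f) := by
    obtain ⟨k, hk⟩ := (Nat.modEq_iff_dvd' hle).1 hmod.symm
    rcases Nat.eq_zero_or_pos k with rfl | hk0
    · lia
    · have := Nat.le_mul_of_pos_right p hk0
      lia
  have huniv : Function.fixedPoints f = Set.univ :=
    Set.eq_of_subset_of_ncard_le (Set.subset_univ _) (by rw [Set.ncard_univ, heq]; rfl)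
  exact funext fun x => (huniv ▸ Set.mem_univ x : x ∈ Function.fixedPoints f)

end PrimePeriodic

section NormalClosureOfPrimeDegree

theorem mem_fixedField_zpowers_iff {K E : Type*} [Field K] [Field E] [Algebra K E] {σ : E ≃ₐ[K] E}
    {x : E} : x ∈ IntermediateField.fixedField (Subgroup.zpowers σ) ↔ σ x = x := by
  rw [IntermediateField.mem_fixedField_iff]
  exact ⟨fun h => h σ (Subgroup.mem_zpowers σ), fun h τ hτ =>
    (Subgroup.zpowers_le (H := MulAction.stabilizer (E ≃ₐ[K] E) x)).2 h hτ⟩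

theorem mem_range_of_map_eq_self {K L E : Type*} [Field K] [Field L] [Algebra K L] [Field E]
    [Algebra K E] [Algebra L E] [IsScalarTower K L E] (hdeg : (Module.finrank K L).Prime)
    {σ : E ≃ₐ[K] E} {y : L} (hy : σ (algebraMap L E y) ≠ algebraMap L E y) {x : L}
    (hx : σ (algebraMap L E x) = algebraMap L E x) : x ∈ Set.range (algebraMap K L) := by
  set M : IntermediateField K L :=
    (IntermediateField.fixedField (Subgroup.zpowers σ)).comap (IsScalarTower.toAlgHom K L E)
  have hM {z : L} : z ∈ M ↔ σ (algebraMap L E z) = algebraMap L E z := mem_fixedField_zpowers_iff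
  have := IntermediateField.isSimpleOrder_of_finrank_prime K L hdeg
  rcases eq_bot_or_eq_top M with hbot | htop
  · exact IntermediateField.mem_bot.1 (hbot ▸ hM.2 hx)
  · exact absurd (hM.1 (htop ▸ trivial)) hy

variable (K L E : Type*) [Field K] [Field L] [Algebra K L] [Field E] [Algebra K E]

theorem normalClosure_eq_top_of_isNormalClosure [FiniteDimensional K L] [IsNormalClosure K L E] :
    IntermediateField.normalClosure K L E = ⊤ :=
  (Algebra.IsAlgebraic.isNormalClosure_iff.1 inferInstance).2

theorem finiteDimensional_of_isNormalClosure [FiniteDimensional K L] [IsNormalClosure K L E] :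
    FiniteDimensional K E := by
  have : FiniteDimensional K (⊤ : IntermediateField K E) := by
    rw [← normalClosure_eq_top_of_isNormalClosure K L E]
    infer_instance
  exact IntermediateField.topEquiv.toLinearEquiv.finiteDimensional

theorem isGalois_of_isNormalClosure [FiniteDimensional K L] [IsNormalClosure K L E] [CharZero K] :
    IsGalois K E := by
  have : FiniteDimensional K E := finiteDimensional_of_isNormalClosure K L E
  have : Normal K E := IsNormalClosure.normal (F := K) (K := L) (L := E)
  exact ⟨⟩

variable {K L E} [FiniteDimensional K L] [IsNormalClosure K L E] [Algebra L E] [IsScalarTower K L E]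

/-- `σ` permutes the at most `p` embeddings of `L` into `E`, and fixes the inclusion. -/
theorem eq_one_of_pow_prime_eq_one_of_map_eq_self {p : ℕ} [Fact p.Prime]
    (hdeg : Module.finrank K L = p) {σ : E ≃ₐ[K] E} (hσp : σ ^ p = 1)
    (hσ : ∀ x : L, σ (algebraMap L E x) = algebraMap L E x) : σ = 1 := by
  have hiter (n : ℕ) (f : L →ₐ[K] E) (x : L) :
      ((fun f : L →ₐ[K] E => (σ : E →ₐ[K] E).comp f)^[n] f) x = (σ ^ n) (f x) := by
    induction n generalizing f with
    | zero => rfl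
    | succ n ih => rw [Function.iterate_succ_apply, ih, pow_succ]; rfl
  have hid : (fun f : L →ₐ[K] E => (σ : E →ₐ[K] E).comp f) = id :=
    eq_id_of_iterate_prime_eq_id (funext fun f => AlgHom.ext fun x => by rw [hiter, hσp]; rfl)
      (hdeg ▸ card_algHom_le_finrank K L E) (x₀ := IsScalarTower.toAlgHom K L E)
      (AlgHom.ext hσ)
  have htop : IntermediateField.fixedField (Subgroup.zpowers σ) = ⊤ := by
    rw [eq_top_iff, ← normalClosure_eq_top_of_isNormalClosure K L E]
    refine normalClosure_le_iff.2 fun f => ?_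
    rintro _ ⟨x, rfl⟩
    exact mem_fixedField_zpowers_iff.2 (DFunLike.congr_fun (congrFun hid f) x)
  exact AlgEquiv.ext fun x => mem_fixedField_zpowers_iff.1 (htop ▸ trivial)

variable [CharZero K]

variable (K L E) in
theorem not_dvd_finrank_of_isNormalClosure {p : ℕ} [Fact p.Prime]
    (hdeg : Module.finrank K L = p) : ¬ p ∣ Module.finrank L E := by
  have := finiteDimensional_of_isNormalClosure K L E
  have : FiniteDimensional L E := FiniteDimensional.right K L E
  have := isGalois_of_isNormalClosure K L E
  have : IsGalois L E := IsGalois.tower_top_of_isGalois K L E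
  rw [← IsGalois.card_aut_eq_finrank]
  intro hdvd
  obtain ⟨τ, hτ⟩ := exists_prime_orderOf_dvd_card' p hdvd
  have hinj := AlgEquiv.restrictScalarsHom_injective (S := L) (A := E) K
  have hρ : orderOf (AlgEquiv.restrictScalarsHom K τ) = p := (orderOf_injective _ hinj τ).trans hτ
  have hρ1 : AlgEquiv.restrictScalarsHom K τ = 1 :=
    eq_one_of_pow_prime_eq_one_of_map_eq_self hdeg (hρ ▸ pow_orderOf_eq_one _) τ.commutes
  rw [hρ1, orderOf_one] at hρ
  exact (Fact.out : p.Prime).one_lt.ne hρ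

variable (K L E) in
theorem exists_algEquiv_orderOf_eq {p : ℕ} [Fact p.Prime] (hdeg : Module.finrank K L = p) :
    ∃ σ : E ≃ₐ[K] E, orderOf σ = p := by
  have := finiteDimensional_of_isNormalClosure K L E
  have := isGalois_of_isNormalClosure K L E
  refine exists_prime_orderOf_dvd_card' p ?_
  rw [IsGalois.card_aut_eq_finrank, ← Module.finrank_mul_finrank K L E, hdeg]
  exact dvd_mul_right _ _

end NormalClosureOfPrimeDegree

section Ramification

variable {p : ℕ} [Fact p.Prime] {K E : Type*} [Field K] [Algebra ℚ_[p] K] [Field E]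
  [Algebra ℚ_[p] E] [Algebra K E] [IsScalarTower ℚ_[p] K E]

theorem padicVal_algEquiv [Algebra.IsAlgebraic ℚ_[p] E] (σ : E ≃ₐ[K] E) (x : E) :
    padicVal p E (σ x) = padicVal p E x :=
  padicVal_map p ((σ : E →ₐ[K] E).restrictScalars ℚ_[p]) x

theorem padicVal_algebraMap [Algebra.IsAlgebraic ℚ_[p] K] [Algebra.IsAlgebraic ℚ_[p] E] (x : K) :
    padicVal p E (algebraMap K E x) = padicVal p K x :=
  padicVal_map p (IsScalarTower.toAlgHom ℚ_[p] K E) x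

variable [FiniteDimensional ℚ_[p] E] {ϖ : ringOfIntegers p E} (hϖ : Irreducible ϖ)
  {σ : E ≃ₐ[K] E}
include hϖ

theorem mem_ramificationGroup_natCast_iff {n : ℕ} :
    σ ∈ ramificationGroup p K E n ↔
      ∀ x : E, padicVal p E x ≤ 1 → padicVal p E (σ x - x) ≤ padicVal p E ϖ ^ (n + 1) := by
  have hmem : σ ∈ ramificationGroup p K E n ↔
      ∀ x : ringOfIntegers p E, σ • x - x ∈ primeIdeal p E ^ (n + 1) := Iff.rfl
  simp only [hmem, mem_primeIdeal_pow_iff hϖ]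
  exact ⟨fun h x hx => h ⟨x, (padicVal_le_one_iff p).1 hx⟩,
    fun h x => h x ((padicVal_le_one_iff p).2 x.2)⟩

theorem padicVal_map_sub_le_of_lt_one {n : ℕ} (hσ : σ ∈ ramificationGroup p K E n)
    (hσϖ : padicVal p E (σ ϖ - ϖ) ≤ padicVal p E ϖ ^ (n + 2)) {x : E} (hx : padicVal p E x < 1) :
    padicVal p E (σ x - x) ≤ padicVal p E ϖ ^ (n + 2) := by
  have hϖ0 : (ϖ : E) ≠ 0 := (Valuation.pos_iff _).1 (padicVal_irreducible_pos hϖ)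
  obtain ⟨y, rfl⟩ : ∃ y, x = y * ϖ := ⟨x / ϖ, (div_mul_cancel₀ x hϖ0).symm⟩
  have hy : padicVal p E y ≤ 1 := by
    rw [padicVal_lt_one_iff_le hϖ, map_mul] at hx
    exact (mul_le_iff_le_one_left (padicVal_irreducible_pos hϖ)).1 hx
  have hleibniz : σ (y * ϖ) - y * ϖ = σ y * (σ ϖ - ϖ) + (σ y - y) * ϖ := by
    rw [map_mul]
    ring
  rw [hleibniz]
  refine Valuation.map_add_le _ ?_ ?_
  · rw [map_mul, padicVal_algEquiv]
    exact (mul_le_of_le_one_left' hy).trans hσϖ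
  · rw [map_mul, pow_succ]
    exact mul_le_mul_left ((mem_ramificationGroup_natCast_iff hϖ).1 hσ y hy) _

/-- For a unit `x` one has `x ≡ x ^ q`, where `q` is a multiple of `p` and `σ x ≡ x`, so that
`σ (x ^ q) ≡ x ^ q` to a higher order. -/
theorem mem_ramificationGroup_succ_of_padicVal_map_sub_le {n : ℕ}
    (hσ : σ ∈ ramificationGroup p K E n)
    (hσϖ : padicVal p E (σ ϖ - ϖ) ≤ padicVal p E ϖ ^ (n + 2)) :
    σ ∈ ramificationGroup p K E (n + 1 : ℕ) := by
  rw [mem_ramificationGroup_natCast_iff hϖ]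
  intro x hx
  rcases hx.lt_or_eq with hx1 | hx1
  · exact padicVal_map_sub_le_of_lt_one hϖ hσ hσϖ hx1
  have hϖ1 := (padicVal_irreducible_lt_one hϖ).le
  obtain ⟨q, hq, hpow⟩ := exists_natCast_pow_sub p (F := E)
  have hx0 : x ≠ 0 := fun h => by simp [h] at hx1
  obtain ⟨w, hw⟩ : ∃ w, σ x - x = x * w := ⟨(σ x - x) / x, (mul_div_cancel₀ _ hx0).symm⟩
  have hvw : padicVal p E w ≤ padicVal p E ϖ ^ (n + 1) := by
    simpa only [hw, map_mul, hx1, one_mul] using (mem_ramificationGroup_natCast_iff hϖ).1 hσ x hx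
  have hsub : σ x - x =
      x ^ q * ((1 + w) ^ q - 1 - q * w + q * w) - (σ (x ^ q - x) - (x ^ q - x)) := by
    rw [map_sub, map_pow, show σ x = x * (1 + w) by linear_combination hw, mul_pow]
    ring
  rw [hsub]
  refine Valuation.map_sub_le _ ?_ (padicVal_map_sub_le_of_lt_one hϖ hσ hσϖ (hpow x hx))
  rw [map_mul, map_pow, hx1, one_pow, one_mul]
  refine Valuation.map_add_le _ ?_ ?_
  · calc padicVal p E ((1 + w) ^ q - 1 - q * w) ≤ padicVal p E w ^ 2 :=
          valuation_one_add_pow_sub_linear_le _ (hvw.trans (pow_le_one' hϖ1 _)) q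
      _ ≤ (padicVal p E ϖ ^ (n + 1)) ^ 2 := by gcongr
      _ = padicVal p E ϖ ^ ((n + 1) * 2) := (pow_mul _ _ _).symm
      _ ≤ padicVal p E ϖ ^ (n + 2) := pow_le_pow_right_of_le_one' hϖ1 (by lia)
  · rw [map_mul, pow_succ, mul_comm]
    exact mul_le_mul' hvw ((padicVal_lt_one_iff_le hϖ).1 hq)

theorem exists_pow_apply_eq_mul_of_map_eq_mul (hσ : σ ∈ ramificationGroup p K E (0 : ℕ)) {θ x : E}
    (hvθ : padicVal p E θ = 1) (hθ : σ x = θ * x) (n : ℕ) :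
    ∃ z, (σ ^ n) x = z * x ∧ padicVal p E (z - θ ^ n) < 1 := by
  induction n with
  | zero => exact ⟨1, by simp⟩
  | succ n ih =>
    obtain ⟨z, hz, hzθ⟩ := ih
    have hvz : padicVal p E z ≤ 1 := by
      rw [← sub_add_cancel z (θ ^ n)]
      exact Valuation.map_add_le _ hzθ.le (by rw [map_pow, hvθ, one_pow])
    have hmove : padicVal p E (σ z - z) < 1 := by
      rw [padicVal_lt_one_iff_le hϖ]
      simpa using (mem_ramificationGroup_natCast_iff hϖ).1 hσ z hvz
    refine ⟨σ z * θ, by rw [pow_succ', AlgEquiv.mul_apply, hz, map_mul, hθ, mul_assoc], ?_⟩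
    rw [pow_succ, ← sub_mul, map_mul, hvθ, mul_one, ← sub_add_sub_cancel]
    exact Valuation.map_add_lt _ hmove hzθ

/-- The class `θ` of `σ ϖ / ϖ` in the residue field satisfies `θ ^ p = 1`, hence `θ = 1`. -/
theorem mem_ramificationGroup_one_of_pow_prime_eq_one (hσp : σ ^ p = 1)
    (hσ : σ ∈ ramificationGroup p K E (0 : ℕ)) : σ ∈ ramificationGroup p K E (1 : ℕ) := by
  have hp : p.Prime := Fact.out
  refine mem_ramificationGroup_succ_of_padicVal_map_sub_le hϖ hσ ?_
  have hϖ0 : (ϖ : E) ≠ 0 := (Valuation.pos_iff _).1 (padicVal_irreducible_pos hϖ)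
  obtain ⟨θ, hθ⟩ : ∃ θ, σ ϖ = θ * ϖ := ⟨σ ϖ / ϖ, (div_mul_cancel₀ _ hϖ0).symm⟩
  have hvθ : padicVal p E θ = 1 := by
    have := padicVal_algEquiv (p := p) σ ϖ
    rwa [hθ, map_mul, mul_eq_right₀ (padicVal_irreducible_pos hϖ).ne'] at this
  have hθp : padicVal p E (1 - θ ^ p) < 1 := by
    obtain ⟨z, hz, hzθ⟩ := exists_pow_apply_eq_mul_of_map_eq_mul hϖ hσ hvθ hθ p
    rw [hσp, AlgEquiv.one_apply, eq_comm, mul_eq_right₀ hϖ0] at hz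
    rwa [hz] at hzθ
  have hpow : padicVal p E ((θ - 1) ^ p) < 1 := by
    have hadd := valuation_add_pow_prime_sub_le (padicVal p E) hp (x := θ - 1) (y := 1) (M := 1)
      (Valuation.map_sub_le _ hvθ.le (map_one _).le) (map_one _).le
    rw [one_pow, one_pow, mul_one, sub_add_cancel] at hadd
    rw [show (θ - 1) ^ p = -(1 - θ ^ p) - (θ ^ p - ((θ - 1) ^ p + 1)) by ring]
    exact Valuation.map_sub_lt _ ((Valuation.map_neg _ _).trans_lt hθp)
      (hadd.trans_lt (padicVal_prime_lt_one p))
  rw [map_pow, pow_lt_one_iff_of_nonneg zero_le hp.ne_zero, padicVal_lt_one_iff_le hϖ] at hpow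
  rw [hθ, ← sub_one_mul, map_mul, zero_add, pow_two]
  exact mul_le_mul_left hpow _

theorem padicVal_div_sub_one_eq_of_eq_pow {t : ℕ} (ht : 1 ≤ t)
    (hσ : σ ∈ ramificationGroup p K E t)
    (hσϖ : padicVal p E (σ ϖ - ϖ) = padicVal p E ϖ ^ (t + 1)) {m : ℕ} (hm : ¬ p ∣ m) {x : E}
    (hx : padicVal p E x = padicVal p E ϖ ^ m) :
    padicVal p E (σ x / x - 1) = padicVal p E ϖ ^ t := by
  have hpos := padicVal_irreducible_pos hϖ
  have hlt := padicVal_irreducible_lt_one hϖ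
  have hϖ0 : (ϖ : E) ≠ 0 := (Valuation.pos_iff _).1 hpos
  obtain ⟨u, rfl⟩ : ∃ u, x = u * ϖ ^ m := ⟨x / ϖ ^ m, by field_simp⟩
  have hvu : padicVal p E u = 1 := by
    rwa [map_mul, map_pow, mul_eq_right₀ (pow_pos hpos m).ne'] at hx
  have hu0 : u ≠ 0 := fun h => by simp [h] at hvu
  obtain ⟨w, hw⟩ : ∃ w, σ ϖ - ϖ = w * ϖ := ⟨_, (div_mul_cancel₀ _ hϖ0).symm⟩
  obtain ⟨ε, hε⟩ : ∃ ε, σ u - u = ε * u := ⟨_, (div_mul_cancel₀ _ hu0).symm⟩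
  have hvw : padicVal p E w = padicVal p E ϖ ^ t := by
    rwa [hw, map_mul, pow_succ, mul_left_inj' hpos.ne'] at hσϖ
  have hvε : padicVal p E ε ≤ padicVal p E ϖ ^ (t + 1) := by
    simpa only [hε, map_mul, hvu, mul_one] using
      (mem_ramificationGroup_natCast_iff hϖ).1 hσ u hvu.le
  have hw1 : padicVal p E w < 1 := hvw ▸ pow_lt_one₀ zero_le hlt (by lia)
  have hquot : σ (u * ϖ ^ m) / (u * ϖ ^ m) - 1 = ((1 + w) ^ m - 1) + (1 + w) ^ m * ε := by
    rw [map_mul, map_pow, sub_eq_iff_eq_add.1 hw, sub_eq_iff_eq_add.1 hε, ← add_one_mul,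
      ← add_one_mul, mul_pow]
    field_simp
    ring
  have hmain : padicVal p E ((1 + w) ^ m - 1) = padicVal p E ϖ ^ t := by
    rw [valuation_one_add_pow_sub_one _ hw1 (padicVal_natCast_eq_one p hm), hvw]
  rw [hquot, Valuation.map_add_eq_of_lt_left, hmain]
  rw [hmain, map_mul, map_pow, Valuation.map_one_add_of_lt _ hw1, one_pow, one_mul]
  exact hvε.trans_lt (pow_lt_pow_right_of_lt_one₀ hpos hlt (by lia))

theorem padicVal_div_sub_one_eq_of_eq_zpow {t : ℕ} (ht : 1 ≤ t)
    (hσ : σ ∈ ramificationGroup p K E t)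
    (hσϖ : padicVal p E (σ ϖ - ϖ) = padicVal p E ϖ ^ (t + 1)) {m : ℤ} (hm : ¬ (p : ℤ) ∣ m) {x : E}
    (hx : padicVal p E x = padicVal p E ϖ ^ m) :
    padicVal p E (σ x / x - 1) = padicVal p E ϖ ^ t := by
  obtain ⟨n, rfl | rfl⟩ := Int.eq_nat_or_neg m
  · rw [Int.natCast_dvd_natCast] at hm
    exact padicVal_div_sub_one_eq_of_eq_pow hϖ ht hσ hσϖ hm (hx.trans (zpow_natCast _ _))
  rw [dvd_neg, Int.natCast_dvd_natCast] at hm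
  have hx0 : padicVal p E x ≠ 0 := hx ▸ zpow_ne_zero _ (padicVal_irreducible_pos hϖ).ne'
  have hquot : padicVal p E (σ x / x) = 1 := by
    rw [map_div₀, padicVal_algEquiv, div_self hx0]
  rw [← valuation_inv_sub_one _ hquot, inv_div, ← inv_div_inv, ← map_inv₀ σ]
  refine padicVal_div_sub_one_eq_of_eq_pow hϖ ht hσ hσϖ hm ?_
  rw [map_inv₀, hx, zpow_neg, inv_inv, zpow_natCast]

theorem dvd_of_padicVal_algebraMap_eq_zpow {t : ℕ} (ht : 1 ≤ t)
    (hσ : σ ∈ ramificationGroup p K E t)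
    (hσϖ : padicVal p E (σ ϖ - ϖ) = padicVal p E ϖ ^ (t + 1)) {c : K} {m : ℤ}
    (hc : padicVal p E (algebraMap K E c) = padicVal p E ϖ ^ m) : (p : ℤ) ∣ m := by
  have hpos := padicVal_irreducible_pos hϖ
  have hc0 : algebraMap K E c ≠ 0 := by
    rw [← Valuation.ne_zero_iff (padicVal p E), hc]
    exact zpow_ne_zero _ hpos.ne'
  by_contra hm
  have hdisp := padicVal_div_sub_one_eq_of_eq_zpow hϖ ht hσ hσϖ hm hc
  rw [AlgEquiv.commutes, div_self hc0, sub_self, map_zero] at hdisp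
  exact (pow_pos hpos t).ne hdisp

theorem isTotallyRamifiedGenerator_of_padicVal_map_sub_eq {L : Type*} [Field L]
    [Algebra ℚ_[p] L] [FiniteDimensional ℚ_[p] L] [Algebra K L] [Algebra L E]
    [IsScalarTower ℚ_[p] L E] [IsScalarTower K L E] {t : ℕ} (ht : 1 ≤ t)
    (hσ : σ ∈ ramificationGroup p K E t)
    (hσϖ : padicVal p E (σ ϖ - ϖ) = padicVal p E ϖ ^ (t + 1)) {π : ringOfIntegers p L}
    (hπ : Irreducible π) {R : ℕ} (hR : ¬ p ∣ R) (hπϖ : padicVal p L π = padicVal p E ϖ ^ R) :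
    IsTotallyRamifiedGenerator K (padicVal p L) p (π : L) := by
  refine ⟨padicVal_irreducible_pos hπ, padicVal_irreducible_lt_one hπ, fun c hc => ?_⟩
  obtain ⟨k, hk⟩ := exists_padicVal_eq_zpow hπ (by simpa using hc : algebraMap K L c ≠ 0)
  have hdvd : (p : ℤ) ∣ R * k := by
    refine dvd_of_padicVal_algebraMap_eq_zpow hϖ ht hσ hσϖ (c := c) ?_
    rw [IsScalarTower.algebraMap_apply K L E, padicVal_algebraMap, hk, hπϖ, zpow_mul,
      zpow_natCast]
  obtain ⟨n, rfl⟩ := (Int.Prime.dvd_mul' Fact.out hdvd).resolve_left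
    fun h => hR (Int.natCast_dvd_natCast.1 h)
  exact ⟨n, hk⟩

theorem dvd_finrank_of_padicVal_eq_pow [FiniteDimensional ℚ_[p] K] [IsGalois K E]
    {π : ringOfIntegers p K} (hπ : Irreducible π) {R : ℕ}
    (hR : padicVal p K π = padicVal p E ϖ ^ R) : R ∣ Module.finrank K E := by
  have : FiniteDimensional K E := FiniteDimensional.right ℚ_[p] K E
  have hpos := padicVal_irreducible_pos hϖ
  have hnorm : padicVal p K (Algebra.norm K (ϖ : E)) = padicVal p E ϖ ^ Module.finrank K E := by
    rw [← padicVal_algebraMap (E := E), Algebra.norm_eq_prod_automorphisms, map_prod]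
    simp only [padicVal_algEquiv]
    rw [Finset.prod_const, Finset.card_univ, ← Nat.card_eq_fintype_card,
      IsGalois.card_aut_eq_finrank]
  obtain ⟨n, hn⟩ := exists_padicVal_eq_zpow hπ
    (Algebra.norm_ne_zero_iff.2 ((Valuation.pos_iff _).1 hpos) : Algebra.norm K (ϖ : E) ≠ 0)
  rw [hnorm, hR, ← zpow_natCast, ← zpow_natCast, ← zpow_mul] at hn
  exact Int.natCast_dvd_natCast.1
    ⟨n, zpow_right_injective₀ hpos (padicVal_irreducible_lt_one hϖ).ne hn⟩

end Ramification

section RamificationJump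

variable {p : ℕ} [Fact p.Prime] {K E : Type*} [Field K] [Algebra ℚ_[p] K] [Field E]
  [Algebra ℚ_[p] E] [Algebra K E] [IsScalarTower ℚ_[p] K E] {t : ℤ}
  (h : IsRamificationJump p K E t)
include h

namespace IsRamificationJump

theorem exists_mem_ne_one : ∃ σ ∈ ramificationGroup p K E t, σ ≠ 1 ∧ σ ^ p = 1 := by
  obtain ⟨hcard, -⟩ := h
  have hne : ramificationGroup p K E t ≠ ⊥ := fun hbot => by
    rw [hbot, Subgroup.card_bot] at hcard
    exact (Fact.out : p.Prime).one_lt.ne hcard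
  obtain ⟨σ, hσ, hσ1⟩ := (ramificationGroup p K E t).bot_or_exists_ne_one.resolve_left hne
  refine ⟨σ, hσ, hσ1, ?_⟩
  have hpow := pow_card_eq_one' (x := (⟨σ, hσ⟩ : ramificationGroup p K E t))
  rw [hcard] at hpow
  exact congrArg Subtype.val hpow

theorem neg_one_le : -1 ≤ t := by
  by_contra! ht
  obtain ⟨σ, hσ, hσ1, -⟩ := h.exists_mem_ne_one
  have heq : ramificationGroup p K E t = ramificationGroup p K E (t + 1) := by
    rw [ramificationGroup, ramificationGroup,
      show (t + 1).toNat = (t + 1 + 1).toNat by lia]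
  rw [heq, h.2] at hσ
  exact hσ1 (Subgroup.mem_bot.1 hσ)

variable [FiniteDimensional ℚ_[p] E] {ϖ : ringOfIntegers p E} (hϖ : Irreducible ϖ)
include hϖ

theorem exists_padicVal_map_sub_eq (ht : (p : ℤ) ∣ t) :
    ∃ (T : ℕ) (σ : E ≃ₐ[K] E), p ∣ T ∧ 1 ≤ T ∧ σ ∈ ramificationGroup p K E T ∧
      padicVal p E (σ ϖ - ϖ) = padicVal p E ϖ ^ (T + 1) := by
  have hp : p.Prime := Fact.out
  have ht0 : t ≠ -1 := fun h1 =>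
    hp.one_lt.ne' (Nat.dvd_one.1 (by exact_mod_cast dvd_neg.1 (h1 ▸ ht)))
  obtain ⟨T, rfl⟩ := Int.eq_ofNat_of_zero_le (by have := h.neg_one_le; lia : 0 ≤ t)
  obtain ⟨σ, hσ, hσ1, hσp⟩ := h.exists_mem_ne_one
  have hnotMem : σ ∉ ramificationGroup p K E (T + 1 : ℕ) := fun hmem => by
    rw [Nat.cast_succ, h.2] at hmem
    exact hσ1 (Subgroup.mem_bot.1 hmem)
  have hlt : padicVal p E ϖ ^ (T + 2) < padicVal p E (σ ϖ - ϖ) := not_le.1 fun hle =>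
    hnotMem (mem_ramificationGroup_succ_of_padicVal_map_sub_le hϖ hσ hle)
  have hle := (mem_ramificationGroup_natCast_iff hϖ).1 hσ ϖ (padicVal_irreducible_lt_one hϖ).le
  refine ⟨T, σ, Int.natCast_dvd_natCast.1 ht, Nat.one_le_iff_ne_zero.2 ?_, hσ, ?_⟩
  · rintro rfl
    exact hnotMem (mem_ramificationGroup_one_of_pow_prime_eq_one hϖ hσp hσ)
  obtain ⟨k, hk⟩ := exists_padicVal_eq_zpow hϖ
    ((Valuation.ne_zero_iff _).1 (zero_le.trans_lt hlt).ne')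
  have hpos := padicVal_irreducible_pos hϖ
  have hϖ1 := padicVal_irreducible_lt_one hϖ
  rw [hk, ← zpow_natCast] at hle hlt ⊢
  rw [zpow_le_zpow_iff_right_of_lt_one₀ hpos hϖ1] at hle
  rw [zpow_lt_zpow_iff_right_of_lt_one₀ hpos hϖ1] at hlt
  congr 1
  lia

end IsRamificationJump

end RamificationJump

section GeneratingRoot

variable {p : ℕ} [Fact p.Prime] {K L : Type*} [Field K] [Algebra ℚ_[p] K]
  [FiniteDimensional ℚ_[p] K] [Field L] [Algebra ℚ_[p] L] [FiniteDimensional ℚ_[p] L] [Algebra K L]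
  [IsScalarTower ℚ_[p] K L]

theorem IsGeneratingRoot.isTotallyRamifiedGenerator {α : L} (hα : IsGeneratingRoot p K α) :
    IsTotallyRamifiedGenerator K (padicVal p L) p α := by
  obtain ⟨⟨ϖ, hϖ, hpow⟩, -⟩ := hα
  have hp : p ≠ 0 := (Fact.out : p.Prime).ne_zero
  have hval : padicVal p L α ^ p = padicVal p K ϖ := by
    rw [← map_pow, hpow, padicVal_algebraMap]
  refine ⟨pow_pos_iff hp |>.1 (hval ▸ padicVal_irreducible_pos hϖ),
    (pow_lt_one_iff_of_nonneg zero_le hp).1 (hval ▸ padicVal_irreducible_lt_one hϖ),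
    fun c hc => ?_⟩
  obtain ⟨k, hk⟩ := exists_padicVal_eq_zpow hϖ hc
  exact ⟨k, by rw [padicVal_algebraMap, hk, ← hval, zpow_mul, zpow_natCast]⟩

theorem IsTotallyRamifiedGenerator.isGeneratingRoot {α : L}
    (h : IsTotallyRamifiedGenerator K (padicVal p L) p α) (hdeg : Module.finrank K L = p) {a : K}
    (ha : α ^ p = algebraMap K L a) : IsGeneratingRoot p K α := by
  have hp : p ≠ 0 := (Fact.out : p.Prime).ne_zero
  have hva : padicVal p K a = padicVal p L α ^ p := by
    rw [← padicVal_algebraMap (E := L), ← ha, map_pow]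
  have ha0 : a ≠ 0 := (Valuation.pos_iff _).1 (hva ▸ pow_pos h.pos p)
  have ha1 : padicVal p K a < 1 := hva ▸ pow_lt_one₀ zero_le h.lt_one hp
  lift a to ringOfIntegers p K using (padicVal_le_one_iff p).1 ha1.le
  obtain ⟨ϖ, hϖ⟩ := IsDiscreteValuationRing.exists_irreducible (ringOfIntegers p K)
  obtain ⟨k, hk⟩ := h.exists_zpow_eq ϖ ((Valuation.pos_iff _).1 (padicVal_irreducible_pos hϖ))
  rw [padicVal_algebraMap, zpow_mul, zpow_natCast, ← hva] at hk
  have hle : padicVal p K ϖ ≤ padicVal p K a := by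
    have hk0 : 0 < k := (zpow_lt_one_iff_right_of_lt_one₀ ((Valuation.pos_iff _).2 ha0) ha1).1
      (hk ▸ padicVal_irreducible_lt_one hϖ)
    rw [hk]
    exact (zpow_le_zpow_right_of_le_one₀ ((Valuation.pos_iff _).2 ha0) ha1.le hk0).trans_eq
      (zpow_one _)
  have hassoc : Associated ϖ a :=
    associated_of_dvd_dvd ((integers_padicVal p).dvd_of_le ((padicVal_lt_one_iff_le hϖ).1 ha1))
      ((integers_padicVal p).dvd_of_le hle)
  exact ⟨⟨a, hassoc.irreducible hϖ, ha⟩, h.adjoin_eq_top hdeg⟩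

theorem exists_isGeneratingRoot_of_isApproximateRoot (hdeg : Module.finrank K L = p) {π : L}
    (h : IsTotallyRamifiedGenerator K (padicVal p L) p π)
    (hπ : IsApproximateRoot K (padicVal p L) p (padicVal p L π) π) :
    ∃ α : L, IsGeneratingRoot p K α := by
  have hp : p.Prime := Fact.out
  have : CharZero L := charZero_of_injective_algebraMap (algebraMap ℚ_[p] L).injective
  obtain ⟨ε, hε, hroot⟩ := exists_pow_prime_eq_one_add p (F := L)
  obtain ⟨m, hm⟩ := exists_pow_lt_of_lt_one hε h.lt_one
  obtain ⟨π', hπ', happrox⟩ := h.exists_isApproximateRoot_pow hp hdeg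
    (Nat.cast_ne_zero.2 hp.ne_zero) h.lt_one hπ m
  obtain ⟨α, a, hα, ha⟩ := happrox.exists_pow_eq_algebraMap hp.ne_zero fun y hy => by
    have hle : padicVal p L y ≤ padicVal p L π ^ 2 ^ m :=
      hy.trans (mul_le_of_le_one_left' (valuation_natCast_le_one _ p))
    exact ⟨hle.trans_lt (pow_lt_one₀ zero_le h.lt_one (by positivity)),
      hroot y ((hle.trans (pow_le_pow_right_of_le_one' h.lt_one.le m.lt_two_pow_self.le)).trans_lt
        hm)⟩
  exact ⟨α, (h.of_valuation_eq (hα.trans hπ')).isGeneratingRoot hdeg ha⟩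

variable {E : Type*} [Field E] [Algebra ℚ_[p] E] [FiniteDimensional ℚ_[p] E] [Algebra K E]
  [Algebra L E] [IsScalarTower ℚ_[p] K E] [IsScalarTower ℚ_[p] L E] [IsScalarTower K L E]

theorem exists_isGeneratingRoot_of_padicVal_map_sub_eq (hdeg : Module.finrank K L = p)
    {ϖ : ringOfIntegers p E} (hϖ : Irreducible ϖ) {π : ringOfIntegers p L} (hπ : Irreducible π)
    {R : ℕ} (hR : ¬ p ∣ R) (hπϖ : padicVal p L π = padicVal p E ϖ ^ R) {T : ℕ} (hpT : p ∣ T)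
    (hT : 1 ≤ T) {σ : E ≃ₐ[K] E} (hσ : σ ∈ ramificationGroup p K E T)
    (hσϖ : padicVal p E (σ ϖ - ϖ) = padicVal p E ϖ ^ (T + 1)) :
    ∃ α : L, IsGeneratingRoot p K α := by
  have hp : p.Prime := Fact.out
  have : CharZero K := charZero_of_injective_algebraMap (algebraMap ℚ_[p] K).injective
  have hpos := padicVal_irreducible_pos hϖ
  have hlt := padicVal_irreducible_lt_one hϖ
  have hgen := isTotallyRamifiedGenerator_of_padicVal_map_sub_eq hϖ hT hσ hσϖ hπ hR hπϖ
  have hπE : padicVal p E (algebraMap L E π) = padicVal p E ϖ ^ R := by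
    rw [padicVal_algebraMap, hπϖ]
  have hπ0 : algebraMap L E π ≠ 0 :=
    (Valuation.pos_iff (padicVal p E)).1 (hπE ▸ pow_pos hpos R)
  have hw : padicVal p E (σ (algebraMap L E π) / algebraMap L E π - 1) = padicVal p E ϖ ^ T :=
    padicVal_div_sub_one_eq_of_eq_pow hϖ hT hσ hσϖ hR hπE
  have happrox : IsApproximateRoot K (padicVal p L) p (padicVal p L π) (π : L) :=
    hgen.isApproximateRoot (padicVal_algebraMap (K := L) (E := E)) (σ : E →ₐ[K] E)
      (hw ▸ pow_lt_one₀ zero_le hlt (by lia))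
      (by rw [add_sub_cancel, mul_div_cancel₀ _ hπ0]; rfl) hp hdeg (Nat.cast_ne_zero.2 hp.ne_zero)
      (fun i hi hip => padicVal_natCast_eq_one p (Nat.not_dvd_of_pos_of_lt hi hip))
      hpos hlt hR hπϖ hpT hw
  exact exists_isGeneratingRoot_of_isApproximateRoot hdeg hgen happrox

end GeneratingRoot

section MaximallyRamified

variable {p : ℕ} [Fact p.Prime] {K L E : Type*} [Field K] [Algebra ℚ_[p] K]
  [Field L] [Algebra ℚ_[p] L] [Algebra K L] [Field E] [Algebra ℚ_[p] E] [Algebra K E]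
  [Algebra L E] [IsScalarTower ℚ_[p] K E] [IsScalarTower ℚ_[p] L E]

theorem IsMaximallyRamified.exists_isRamificationJump (h : IsMaximallyRamified p K L E) :
    ∃ t : ℤ, IsRamificationJump p K E t ∧ (p : ℤ) ∣ t := by
  obtain ⟨t, r, c, ℓ, ht, -, -, hℓ, hmod⟩ := h
  have hdvd : (p : ℤ) ∣ p * c * (r - 1) + t :=
    hℓ ▸ (Int.dvd_of_emod_eq_zero hmod).mul_left r
  exact ⟨t, ht, (Int.dvd_add_right ⟨c * (r - 1), mul_assoc _ _ _⟩).1 hdvd⟩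

variable [FiniteDimensional ℚ_[p] K] [IsScalarTower ℚ_[p] K L] [IsScalarTower K L E]

theorem IsMaximallyRamified.exists_isGeneratingRoot [IsNormalClosure K L E]
    (h : IsMaximallyRamified p K L E) (hdeg : Module.finrank K L = p) :
    ∃ α : L, IsGeneratingRoot p K α := by
  have : CharZero K := charZero_of_injective_algebraMap (algebraMap ℚ_[p] K).injective
  have : FiniteDimensional K L :=
    Module.finite_of_finrank_pos (hdeg ▸ (Fact.out : p.Prime).pos)
  have := finiteDimensional_of_isNormalClosure K L E
  have := isGalois_of_isNormalClosure K L E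
  have : IsGalois L E := IsGalois.tower_top_of_isGalois K L E
  have : FiniteDimensional ℚ_[p] L := FiniteDimensional.trans ℚ_[p] K L
  have : FiniteDimensional ℚ_[p] E := FiniteDimensional.trans ℚ_[p] K E
  obtain ⟨t, ht, hpt⟩ := h.exists_isRamificationJump
  obtain ⟨ϖ, hϖ⟩ := IsDiscreteValuationRing.exists_irreducible (ringOfIntegers p E)
  obtain ⟨π, hπ⟩ := IsDiscreteValuationRing.exists_irreducible (ringOfIntegers p L)
  obtain ⟨T, σ, hpT, hT, hσ, hσϖ⟩ := ht.exists_padicVal_map_sub_eq hϖ hpt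
  obtain ⟨R, hR⟩ : ∃ R : ℕ, padicVal p L π = padicVal p E ϖ ^ R := by
    rw [← padicVal_algebraMap (E := E)]
    refine exists_padicVal_eq_pow hϖ ((padicVal_le_one_iff p).1 ?_) ?_
    · rw [padicVal_algebraMap]
      exact (padicVal_irreducible_lt_one hπ).le
    · simpa using hπ.ne_zero
  have hpR : ¬ p ∣ R := fun hdvd => not_dvd_finrank_of_isNormalClosure K L E hdeg
    (hdvd.trans (dvd_finrank_of_padicVal_eq_pow hϖ hπ hR))
  exact exists_isGeneratingRoot_of_padicVal_map_sub_eq hdeg hϖ hπ hpR hR hpT hT hσ hσϖ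

end MaximallyRamified

section LiftBaseChange

open TensorProduct

theorem eq_zero_of_liftBaseChange_eq_zero {K E V : Type*} [Field K] [Field E] [Algebra K E]
    [AddCommGroup V] [Module K V] {S : Set (V →ₗ[K] E)} (hS : Submodule.span E S = ⊤) {z : E ⊗[K] V}
    (hz : ∀ f ∈ S, f.liftBaseChange E z = 0) : z = 0 := by
  have hle : Submodule.span E S ≤ LinearMap.ker
      (LinearMap.applyₗ z ∘ₗ (LinearMap.liftBaseChangeEquiv E (M := V) (N := E)).toLinearMap) :=
    Submodule.span_le.2 hz
  refine (Module.forall_dual_apply_eq_zero_iff E z).1 fun φ => ?_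
  obtain ⟨f, rfl⟩ := (LinearMap.liftBaseChangeEquiv E (M := V) (N := E)).surjective φ
  exact hle (hS ▸ Submodule.mem_top : f ∈ Submodule.span E S)

end LiftBaseChange

section HopfGaloisAction

open WithConv

variable {K H L : Type*} [Field K] [Field L] [Algebra K L] [Ring H] [HopfAlgebra K H]
  [Module H L] [IsScalarTower K H L]

theorem IsHopfGalois.finrank_eq [FiniteDimensional K L] (hH : IsHopfGalois K H L) :
    Module.finrank K H = Module.finrank K L := by
  have := hH.finite
  have h := (LinearEquiv.ofBijective _ hH.bijective).finrank_eq
  rw [Module.finrank_tensorProduct, Module.finrank_linearMap] at h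
  exact Nat.eq_of_mul_eq_mul_left Module.finrank_pos h

variable (E : Type*) [Field E] [Algebra K E]

theorem IsHopfGalois.finrank_withConv [FiniteDimensional K L] (hH : IsHopfGalois K H L) :
    Module.finrank E (WithConv (H →ₗ[K] E)) = Module.finrank K L := by
  have := hH.finite
  rw [(WithConv.linearEquiv E (H →ₗ[K] E)).finrank_eq, Module.finrank_linearMap_self, hH.finrank_eq]

theorem IsHopfGalois.finite_withConv (hH : IsHopfGalois K H L) :
    Module.Finite E (WithConv (H →ₗ[K] E)) := by
  have := hH.finite
  exact Module.Finite.equiv (WithConv.linearEquiv E (H →ₗ[K] E)).symm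

variable [Algebra L E] [IsScalarTower K L E]

theorem IsHopfGalois.span_actionMap_eq_top [FiniteDimensional K L] (hH : IsHopfGalois K H L) :
    Submodule.span E (Set.range fun h : H =>
      (IsScalarTower.toAlgHom K L E).toLinearMap ∘ₗ actionMap K H L h) = ⊤ := by
  set S := Submodule.span E (Set.range fun h : H =>
    (IsScalarTower.toAlgHom K L E).toLinearMap ∘ₗ actionMap K H L h)
  have hmem (g : Module.End K L) : (IsScalarTower.toAlgHom K L E).toLinearMap ∘ₗ g ∈ S := by
    obtain ⟨z, rfl⟩ := hH.bijective.2 g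
    induction z with
    | zero => rw [map_zero, LinearMap.comp_zero]; exact zero_mem S
    | add z w hz hw => rw [map_add, LinearMap.comp_add]; exact add_mem hz hw
    | tmul x h =>
      have heq : (IsScalarTower.toAlgHom K L E).toLinearMap ∘ₗ jMap K H L (x ⊗ₜ h) =
          algebraMap L E x • ((IsScalarTower.toAlgHom K L E).toLinearMap ∘ₗ actionMap K H L h) :=
        LinearMap.ext fun y => map_mul (algebraMap L E) x (h • y)
      exact heq ▸ S.smul_mem _ (Submodule.subset_span ⟨h, rfl⟩)
  rw [eq_top_iff]
  rintro f -
  set b := Module.finBasis K L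
  have hf : f = ∑ i, f (b i) •
      ((IsScalarTower.toAlgHom K L E).toLinearMap ∘ₗ (Algebra.linearMap K L ∘ₗ b.coord i)) := by
    refine b.ext fun j => ?_
    simp [LinearMap.sum_apply, Finsupp.single_apply]
  rw [hf]
  exact sum_mem fun i _ => S.smul_mem _ (hmem _)

/-- The orbit map `y ↦ (h ↦ h • y)`, as an algebra map from `L` to the convolution algebra of linear
maps `H → E`. -/
def orbitMap (hH : IsHopfGalois K H L) : L →ₐ[K] WithConv (H →ₗ[K] E) :=
  AlgHom.ofLinearMap
    ((WithConv.linearEquiv K (H →ₗ[K] E)).symm.toLinearMap ∘ₗ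
      (IsScalarTower.toAlgHom K L E).toLinearMap.compRight K ∘ₗ (actionMap K H L).flip)
    (by
      apply ofConv_injective
      ext h
      change algebraMap L E (h • 1) = algebraMap K E (Coalgebra.counit (R := K) h)
      rw [hH.smul_one, ← IsScalarTower.algebraMap_apply])
    (fun x y => by
      apply ofConv_injective
      have hmul : (actionMap K H L).flip (x * y) =
          (toConv ((actionMap K H L).flip x) * toConv ((actionMap K H L).flip y)).ofConv :=
        LinearMap.ext fun h => hH.smul_mul h x y
      change (IsScalarTower.toAlgHom K L E).toLinearMap ∘ₗ (actionMap K H L).flip (x * y) = _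
      rw [hmul, LinearMap.algHom_comp_convMul_distrib]
      rfl)

/-- The extension of scalars of the orbit map to `E`; see `orbitEquiv` for its bijectivity. -/
def orbitBaseChange (hH : IsHopfGalois K H L) : E ⊗[K] L →ₐ[E] WithConv (H →ₗ[K] E) :=
  have : IsScalarTower K E (WithConv (H →ₗ[K] E)) := ⟨fun c e f => by ext h; simp⟩
  Algebra.TensorProduct.lift (Algebra.ofId E _) (orbitMap E hH) fun e _ => Algebra.commutes e _

theorem orbitBaseChange_tmul (hH : IsHopfGalois K H L) (e : E) (y : L) :
    orbitBaseChange E hH (e ⊗ₜ y) = e • orbitMap E hH y := by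
  rw [Algebra.smul_def]
  rfl

theorem orbitBaseChange_apply (hH : IsHopfGalois K H L) (z : E ⊗[K] L) (h : H) :
    orbitBaseChange E hH z h = LinearMap.liftBaseChange E
      ((IsScalarTower.toAlgHom K L E).toLinearMap ∘ₗ actionMap K H L h) z := by
  induction z with
  | zero => simp
  | add z w hz hw => rw [map_add, map_add, ← hz, ← hw]; rfl
  | tmul e y => rw [orbitBaseChange_tmul]; rfl

theorem orbitBaseChange_bijective [FiniteDimensional K L] (hH : IsHopfGalois K H L) :
    Function.Bijective (orbitBaseChange E hH) := by
  have := hH.finite_withConv E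
  have hinj : Function.Injective (orbitBaseChange E hH) := by
    refine (injective_iff_map_eq_zero _).2 fun z hz =>
      eq_zero_of_liftBaseChange_eq_zero (hH.span_actionMap_eq_top E) ?_
    rintro _ ⟨h, rfl⟩
    rw [← orbitBaseChange_apply E hH, hz]
    rfl
  have hrank : Module.finrank E (E ⊗[K] L) = Module.finrank E (WithConv (H →ₗ[K] E)) := by
    rw [Module.finrank_baseChange, hH.finrank_withConv E]
  exact ⟨hinj, (LinearMap.injective_iff_surjective_of_finrank_eq_finrank
    (f := (orbitBaseChange E hH).toLinearMap) hrank).1 hinj⟩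

/-- The isomorphism between `E ⊗ L` and the convolution algebra of linear maps `H → E`: over `E`,
the Hopf-Galois extension `L` becomes the dual of `H`. -/
def orbitEquiv [FiniteDimensional K L] (hH : IsHopfGalois K H L) :
    E ⊗[K] L ≃ₐ[E] WithConv (H →ₗ[K] E) :=
  AlgEquiv.ofBijective (orbitBaseChange E hH) (orbitBaseChange_bijective E hH)

end HopfGaloisAction

section Characters

open WithConv

variable {K H E : Type*} [Field K] [Field E] [Algebra K E] [Ring H] [HopfAlgebra K H]

variable (H) in
/-- Composition with an automorphism `σ` of `E`, on the convolution algebra of linear maps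
`H → E`. -/
def convComp (σ : E ≃ₐ[K] E) : WithConv (H →ₗ[K] E) →+* WithConv (H →ₗ[K] E) where
  toFun f := toConv ((σ : E →ₐ[K] E).toLinearMap ∘ₗ f.ofConv)
  map_one' := by ext; exact σ.commutes _
  map_mul' f g := ofConv_injective (LinearMap.algHom_comp_convMul_distrib (σ : E →ₐ[K] E) f g)
  map_zero' := by ext; exact map_zero σ
  map_add' f g := by ext h; exact map_add σ (f h) (g h)

theorem convComp_smul (σ : E ≃ₐ[K] E) (e : E) (f : WithConv (H →ₗ[K] E)) :
    convComp H σ (e • f) = σ e • convComp H σ f := by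
  ext h
  exact map_mul σ e (f h)

theorem convComp_convComp (σ τ : E ≃ₐ[K] E) (f : WithConv (H →ₗ[K] E)) :
    convComp H σ (convComp H τ f) = convComp H (σ * τ) f :=
  rfl

/-- The action `χ ↦ σ χ(σ⁻¹ ∘ ·)` of an automorphism `σ` of `E` on the `E`-valued characters of the
convolution algebra of linear maps `H → E`, that is, on the `E`-valued points of `H`. -/
def conjCharacter (σ : E ≃ₐ[K] E) (χ : WithConv (H →ₗ[K] E) →ₐ[E] E) :
    WithConv (H →ₗ[K] E) →ₐ[E] E where
  toRingHom := ((σ : E →+* E).comp χ).comp (convComp H σ⁻¹)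
  commutes' e := by
    change σ (χ (convComp H σ⁻¹ (algebraMap E _ e))) = e
    rw [Algebra.algebraMap_eq_smul_one, convComp_smul, map_smul, map_one, map_one, smul_eq_mul,
      mul_one]
    exact σ.apply_symm_apply e

theorem conjCharacter_apply (σ : E ≃ₐ[K] E) (χ : WithConv (H →ₗ[K] E) →ₐ[E] E)
    (f : WithConv (H →ₗ[K] E)) : conjCharacter σ χ f = σ (χ (convComp H σ⁻¹ f)) :=
  rfl

theorem conjCharacter_iterate (σ : E ≃ₐ[K] E) (n : ℕ) (χ : WithConv (H →ₗ[K] E) →ₐ[E] E) :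
    (conjCharacter σ)^[n] χ = conjCharacter (σ ^ n) χ := by
  induction n with
  | zero => rfl
  | succ n ih =>
    ext f
    rw [Function.iterate_succ_apply', ih, conjCharacter_apply, conjCharacter_apply,
      convComp_convComp, conjCharacter_apply, pow_succ', mul_inv_rev]
    rfl

variable (K H E) in
/-- Evaluation at `1`, the character that is the unit among the `E`-valued points of `H`. -/
def evalOneCharacter : WithConv (H →ₗ[K] E) →ₐ[E] E :=
  AlgHom.ofLinearMap
    (LinearMap.applyₗ' E (1 : H) ∘ₗ (WithConv.linearEquiv E (H →ₗ[K] E)).toLinearMap)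
    (by
      change algebraMap K E (Coalgebra.counit (R := K) (1 : H)) = 1
      simp)
    (fun f g => by
      change LinearMap.mul' K E (TensorProduct.map f.ofConv g.ofConv (Coalgebra.comul 1)) = _
      rw [Bialgebra.comul_one, Algebra.TensorProduct.one_def, TensorProduct.map_tmul,
        LinearMap.mul'_apply]
      rfl)

theorem conjCharacter_evalOneCharacter (σ : E ≃ₐ[K] E) :
    conjCharacter σ (evalOneCharacter K H E) = evalOneCharacter K H E :=
  AlgHom.ext fun f => σ.apply_symm_apply (f 1)

/-- `σ` permutes the at most `p` characters and fixes evaluation at `1`. -/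
theorem character_convComp {p : ℕ} [Fact p.Prime] [Module.Finite E (WithConv (H →ₗ[K] E))]
    (hrank : Module.finrank E (WithConv (H →ₗ[K] E)) = p) {σ : E ≃ₐ[K] E} (hσ : σ ^ p = 1)
    (χ : WithConv (H →ₗ[K] E) →ₐ[E] E) (f : WithConv (H →ₗ[K] E)) :
    χ (convComp H σ f) = σ (χ f) := by
  have hid : conjCharacter σ = (id : (WithConv (H →ₗ[K] E) →ₐ[E] E) → _) :=
    eq_id_of_iterate_prime_eq_id (funext fun χ => by rw [conjCharacter_iterate, hσ]; rfl)
      (hrank ▸ card_algHom_le_finrank E _ E) (conjCharacter_evalOneCharacter σ)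
  have hχ : conjCharacter σ χ = χ := congrFun hid χ
  nth_rw 1 [← hχ]
  rw [conjCharacter_apply, convComp_convComp, inv_mul_cancel]
  rfl

end Characters

section Eigenvectors

open WithConv

/-- `σ` permutes the at most `p` roots of unity of order dividing `p`, and fixes `1`. -/
theorem map_eq_self_of_pow_prime_eq_one {K E : Type*} [Field K] [Field E] [Algebra K E] {p : ℕ}
    [Fact p.Prime] {σ : E ≃ₐ[K] E} (hσ : σ ^ p = 1) {ζ : E} (hζ : ζ ^ p = 1) : σ ζ = ζ := by
  have hsemi : Function.Semiconj (fun ξ : rootsOfUnity p E => ((ξ : Eˣ) : E))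
      (restrictRootsOfUnity σ p) σ := fun _ => rfl
  have hid : ⇑(restrictRootsOfUnity σ p) = id := by
    refine eq_id_of_iterate_prime_eq_id (p := p) (funext fun ξ => ?_) ?_ (map_one _)
    · have hξ := hsemi.iterate_right p ξ
      rw [← AlgEquiv.coe_pow, hσ] at hξ
      exact Subtype.ext (Units.ext hξ)
    · exact card_rootsOfUnity E p
  exact congrArg (fun ξ : rootsOfUnity p E => ((ξ : Eˣ) : E))
    (congrFun hid (rootsOfUnity.mkOfPowEq ζ hζ))

variable {K H L E : Type*} [Field K] [Field L] [Algebra K L] [Field E] [Algebra K E] [Algebra L E]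
  [IsScalarTower K L E]

/-- The powers of `σ` restrict to `p` distinct embeddings of `L`, and distinct embeddings are
linearly independent. -/
theorem span_range_pow_comp_eq_top {p : ℕ} [Fact p.Prime] (hdeg : Module.finrank K L = p)
    {σ : E ≃ₐ[K] E} (hσ : σ ^ p = 1) {y : L} (hy : σ (algebraMap L E y) ≠ algebraMap L E y) :
    Submodule.span E (Set.range fun i : Fin p => AlgHom.toLinearMap
      (((σ ^ (i : ℕ) : E ≃ₐ[K] E) : E →ₐ[K] E).comp (IsScalarTower.toAlgHom K L E))) = ⊤ := by
  have : FiniteDimensional K L :=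
    Module.finite_of_finrank_pos (hdeg ▸ (Fact.out : p.Prime).pos)
  have hperiod : Function.minimalPeriod σ (algebraMap L E y) = p :=
    Function.minimalPeriod_eq_prime
      (by rw [Function.IsPeriodicPt, ← AlgEquiv.coe_pow, hσ]; rfl) hy
  have hinj : Function.Injective fun i : Fin p =>
      ((σ ^ (i : ℕ) : E ≃ₐ[K] E) : E →ₐ[K] E).comp (IsScalarTower.toAlgHom K L E) := by
    intro i j hij
    have hij := DFunLike.congr_fun hij y
    change (σ ^ (i : ℕ)) (algebraMap L E y) = (σ ^ (j : ℕ)) (algebraMap L E y) at hij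
    rw [AlgEquiv.coe_pow, AlgEquiv.coe_pow] at hij
    exact Fin.ext (Function.iterate_injOn_Iio_minimalPeriod
      (by rw [hperiod]; exact i.2) (by rw [hperiod]; exact j.2) hij)
  exact ((linearIndependent_algHom_toLinearMap K L E).comp _ hinj).span_eq_top_of_card_eq_finrank'
    (by rw [Fintype.card_fin, Module.finrank_linearMap_self, hdeg])

variable [Ring H] [HopfAlgebra K H] [Module H L] [IsScalarTower K H L]

/-- The character of the convolution algebra of linear maps `H → E` that corresponds to the
embedding `τ` of `L` under `orbitEquiv`. -/
def characterOfAlgHom [FiniteDimensional K L] (hH : IsHopfGalois K H L) (τ : L →ₐ[K] E) :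
    WithConv (H →ₗ[K] E) →ₐ[E] E :=
  (Algebra.TensorProduct.lift (AlgHom.id E E) τ fun _ _ => Commute.all _ _).comp
    (orbitEquiv E hH).symm

theorem characterOfAlgHom_orbitEquiv [FiniteDimensional K L] (hH : IsHopfGalois K H L)
    (τ : L →ₐ[K] E) (z : E ⊗[K] L) :
    characterOfAlgHom hH τ (orbitEquiv E hH z) = τ.toLinearMap.liftBaseChange E z := by
  rw [characterOfAlgHom, AlgHom.comp_apply, AlgEquiv.coe_toAlgHom, AlgEquiv.symm_apply_apply]
  induction z with
  | zero => rw [map_zero, map_zero]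
  | add z w hz hw => rw [map_add, map_add, hz, hw]
  | tmul e y => rfl

theorem characterOfAlgHom_orbitMap [FiniteDimensional K L] (hH : IsHopfGalois K H L)
    (τ : L →ₐ[K] E) (y : L) : characterOfAlgHom hH τ (orbitMap E hH y) = τ y := by
  have h : orbitMap E hH y = orbitEquiv E hH (1 ⊗ₜ y) :=
    ((orbitBaseChange_tmul E hH 1 y).trans (one_smul E _)).symm
  rw [h, characterOfAlgHom_orbitEquiv, LinearMap.liftBaseChange_one_tmul]
  rfl

theorem eq_zero_of_characterOfAlgHom_eq_zero [FiniteDimensional K L] (hH : IsHopfGalois K H L)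
    {ι : Type*} {τ : ι → L →ₐ[K] E}
    (hτ : Submodule.span E (Set.range fun i => (τ i).toLinearMap) = ⊤) {f : WithConv (H →ₗ[K] E)}
    (hf : ∀ i, characterOfAlgHom hH (τ i) f = 0) : f = 0 := by
  obtain ⟨z, rfl⟩ := (orbitEquiv E hH).surjective f
  have hz : z = 0 := by
    refine eq_zero_of_liftBaseChange_eq_zero hτ ?_
    rintro _ ⟨i, rfl⟩
    rw [← hf i, characterOfAlgHom_orbitEquiv]
  rw [hz, map_zero]

section

variable {p : ℕ} [Fact p.Prime] (hH : IsHopfGalois K H L) (hdeg : Module.finrank K L = p)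
  {σ : E ≃ₐ[K] E} (hσ : σ ^ p = 1) {y₀ : L} (hy₀ : σ (algebraMap L E y₀) ≠ algebraMap L E y₀)
  {ζ : E} (hζ : σ ζ = ζ) {y : L} (hy : σ (algebraMap L E y) = ζ * algebraMap L E y) (h : H)
include hH hdeg hσ hy₀ hζ hy

theorem map_smul_eq_mul : σ (algebraMap L E (h • y)) = ζ * algebraMap L E (h • y) := by
  have : FiniteDimensional K L :=
    Module.finite_of_finrank_pos (hdeg ▸ (Fact.out : p.Prime).pos)
  have := hH.finite_withConv E
  have hrank : Module.finrank E (WithConv (H →ₗ[K] E)) = p := (hH.finrank_withConv E).trans hdeg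
  suffices hzero : convComp H σ (orbitMap E hH y) - ζ • orbitMap E hH y = 0 from
    DFunLike.congr_fun (congrArg ofConv (sub_eq_zero.1 hzero)) h
  refine eq_zero_of_characterOfAlgHom_eq_zero hH (span_range_pow_comp_eq_top hdeg hσ hy₀)
    fun i => ?_
  have hcomm : σ ((σ ^ (i : ℕ)) (algebraMap L E y)) = ζ * (σ ^ (i : ℕ)) (algebraMap L E y) := by
    have hfix : (σ ^ (i : ℕ)) ζ = ζ := by
      rw [AlgEquiv.coe_pow]
      exact Function.iterate_fixed hζ _
    rw [← AlgEquiv.mul_apply, ← pow_succ', pow_succ, AlgEquiv.mul_apply, hy, map_mul, hfix]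
  rw [map_sub, map_smul, character_convComp hrank hσ, characterOfAlgHom_orbitMap]
  exact sub_eq_zero.2 hcomm

theorem exists_smul_eq_smul_of_map_eq_mul : ∃ c : K, h • y = c • y := by
  obtain rfl | hy0 := eq_or_ne y 0
  · exact ⟨0, by rw [smul_zero, smul_zero]⟩
  have hyE : algebraMap L E y ≠ 0 := by simpa using hy0
  have hζ0 : ζ ≠ 0 := by
    rintro rfl
    rw [zero_mul] at hy
    exact hyE (by simpa using hy)
  have hfix : σ (algebraMap L E (h • y / y)) = algebraMap L E (h • y / y) := by
    rw [map_div₀, map_div₀, map_smul_eq_mul hH hdeg hσ hy₀ hζ hy, hy, mul_div_mul_left _ _ hζ0]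
  obtain ⟨c, hc⟩ := mem_range_of_map_eq_self (hdeg ▸ Fact.out) hy₀ hfix
  exact ⟨c, by rw [Algebra.smul_def, hc, div_mul_cancel₀ _ hy0]⟩

end

theorem exists_smul_pow_eq_smul_pow [CharZero K] {p : ℕ} [Fact p.Prime]
    (hH : IsHopfGalois K H L) (hdeg : Module.finrank K L = p) {α : L}
    (hα : α ∉ Set.range (algebraMap K L)) (hpow : α ^ p ∈ Set.range (algebraMap K L)) (h : H)
    (k : ℕ) : ∃ c : K, h • α ^ k = c • α ^ k := by
  have hp : p.Prime := Fact.out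
  have : FiniteDimensional K L := Module.finite_of_finrank_pos (hdeg ▸ hp.pos)
  have : IsAlgClosure K (AlgebraicClosure L) := .ofAlgebraic K L _
  have : Nonempty (L →ₐ[K] AlgebraicClosure L) := ⟨IsScalarTower.toAlgHom K L _⟩
  let E := IntermediateField.normalClosure K L (AlgebraicClosure L)
  obtain ⟨σ, hσ⟩ := exists_algEquiv_orderOf_eq K L E hdeg
  have hσp : σ ^ p = 1 := hσ ▸ pow_orderOf_eq_one σ
  obtain ⟨y, hy⟩ : ∃ y : L, σ (algebraMap L E y) ≠ algebraMap L E y := by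
    by_contra! hfix
    rw [eq_one_of_pow_prime_eq_one_of_map_eq_self hdeg hσp hfix, orderOf_one] at hσ
    exact hp.one_lt.ne hσ
  have hα0 : algebraMap L E α ≠ 0 := by
    rw [map_ne_zero]
    rintro rfl
    exact hα ⟨0, map_zero _⟩
  set ζ := σ (algebraMap L E α) / algebraMap L E α
  have hζp : ζ ^ p = 1 := by
    obtain ⟨a, ha⟩ := hpow
    rw [div_pow, ← map_pow, ← map_pow, ← ha, ← IsScalarTower.algebraMap_apply, σ.commutes,
      div_self]
    rw [IsScalarTower.algebraMap_apply K L E, ha, map_pow]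
    exact pow_ne_zero p hα0
  have hζ : σ (ζ ^ k) = ζ ^ k := by rw [map_pow, map_eq_self_of_pow_prime_eq_one hσp hζp]
  refine exists_smul_eq_smul_of_map_eq_mul hH hdeg hσp hy hζ ?_ h
  rw [map_pow, map_pow, ← mul_pow, div_mul_cancel₀ _ hα0]

end Eigenvectors

section DiagonalAction

variable {K L H ι : Type*} [Field K] [Field L] [Algebra K L] [Ring H] [HopfAlgebra K H]
  [Module H L] [IsScalarTower K H L] {b : Module.Basis ι K L}

theorem IsHopfGalois.eq_zero_of_smul_basis_eq_zero (hH : IsHopfGalois K H L) {h : H}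
    (hh : ∀ i, h • b i = 0) : h = 0 := by
  have hj : jMap K H L (1 ⊗ₜ h) = jMap K H L 0 := b.ext fun i => by
    rw [jMap_tmul_apply, hh, mul_zero, map_zero, LinearMap.zero_apply]
  exact Algebra.TensorProduct.includeRight_injective (R := K) (A := L) (B := H)
    (algebraMap K L).injective ((hH.bijective.1 hj).trans (map_zero _).symm)

theorem exists_algEquiv_smul_basis_eq [Finite ι] (hH : IsHopfGalois K H L)
    (hb : ∀ (h : H) (i : ι), ∃ c : K, h • b i = c • b i) :
    ∃ Λ : H ≃ₐ[K] (ι → K), ∀ (h : H) (i : ι), h • b i = Λ h i • b i := by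
  have := Fintype.ofFinite ι
  have := Module.Finite.of_basis b
  have := hH.finite
  choose eigenvalue heigen using hb
  have hinj (i : ι) {c d : K} (h : c • b i = d • b i) : c = d :=
    smul_left_injective K (b.ne_zero i) h
  let Λ : H →ₐ[K] (ι → K) := AlgHom.ofLinearMap
    { toFun := eigenvalue
      map_add' := fun x y => funext fun i => hinj i (by
        rw [← heigen, add_smul, heigen, heigen, Pi.add_apply, add_smul])
      map_smul' := fun c x => funext fun i => hinj i (by
        rw [← heigen, smul_assoc, heigen, RingHom.id_apply, Pi.smul_apply, smul_assoc]) }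
    (funext fun i => hinj i (by
      change eigenvalue 1 i • _ = (1 : K) • _
      rw [← heigen, one_smul, one_smul]))
    (fun x y => funext fun i => hinj i (by
      change eigenvalue (x * y) i • _ = (eigenvalue x i * eigenvalue y i) • _
      rw [← heigen, mul_smul, heigen y, mul_comm, mul_smul, ← heigen x]
      exact (actionMap K H L x).map_smul (eigenvalue y i) _))
  have hΛ : Function.Injective Λ := (injective_iff_map_eq_zero Λ).2 fun h hh =>
    hH.eq_zero_of_smul_basis_eq_zero (b := b) fun i => by
      rw [heigen, show eigenvalue h i = 0 from congrFun hh i, zero_smul]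
  have hrank : Module.finrank K H = Module.finrank K (ι → K) := by
    rw [hH.finrank_eq, Module.finrank_eq_card_basis b, Module.finrank_fintype_fun_eq_card]
  exact ⟨AlgEquiv.ofBijective Λ ⟨hΛ,
    (LinearMap.injective_iff_surjective_of_finrank_eq_finrank (f := Λ.toLinearMap) hrank).1 hΛ⟩,
    heigen⟩

variable {p : ℕ} [Fact p.Prime] [Algebra ℚ_[p] K] [Algebra ℚ_[p] L]

variable (p) in
/-- The basis `b` of `L/K` is an `𝓞_K`-basis of `𝓞_L`. -/
def IsIntegralBasis (b : Module.Basis ι K L) : Prop :=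
  ∀ x : L, x ∈ ringOfIntegers p L ↔ ∀ i, b.repr x i ∈ ringOfIntegers p K

theorem IsIntegralBasis.mem (hb : IsIntegralBasis p b) (i : ι) : b i ∈ ringOfIntegers p L := by
  classical
  refine (hb (b i)).2 fun j => ?_
  rw [b.repr_self_apply]
  split_ifs
  exacts [one_mem _, zero_mem _]

variable {Λ : H ≃ₐ[K] (ι → K)} (hΛ : ∀ (h : H) (i : ι), h • b i = Λ h i • b i)
include hΛ

theorem repr_smul_eq_mul (h : H) (x : L) (i : ι) : b.repr (h • x) i = Λ h i * b.repr x i := by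
  have hlin : b.coord i ∘ₗ actionMap K H L h = Λ h i • b.coord i := by
    refine b.ext fun j => ?_
    change b.repr (h • b j) i = Λ h i * b.repr (b j) i
    obtain rfl | hij := eq_or_ne j i
    · rw [hΛ, map_smul, Finsupp.smul_apply, smul_eq_mul]
    · rw [hΛ, map_smul, Finsupp.smul_apply, b.repr_self, Finsupp.single_eq_of_ne hij.symm,
        smul_zero, mul_zero]
  exact DFunLike.congr_fun hlin x

variable [IsScalarTower ℚ_[p] K L] (hb : IsIntegralBasis p b)
include hb

theorem mem_associatedOrder_iff {h : H} :
    h ∈ associatedOrder p K H L ↔ ∀ i, Λ h i ∈ ringOfIntegers p K := by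
  refine ⟨fun hh i => ?_, fun hh x hx => (hb _).2 fun i => ?_⟩
  · have hi := (hb _).1 (hh _ (hb.mem i)) i
    rwa [repr_smul_eq_mul hΛ, b.repr_self, Finsupp.single_eq_same, mul_one] at hi
  · rw [repr_smul_eq_mul hΛ]
    exact mul_mem (hh i) ((hb x).1 hx i)

/-- The associated order as the algebra of diagonal matrices with integral entries. -/
def associatedOrderEquiv :
    associatedOrder p K H L ≃ₐ[ringOfIntegers p K] (ι → ringOfIntegers p K) where
  toFun h i := ⟨Λ h i, (mem_associatedOrder_iff hΛ hb).1 h.2 i⟩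
  invFun c := ⟨Λ.symm fun i => c i, (mem_associatedOrder_iff hΛ hb).2 fun i => by
    rw [AlgEquiv.apply_symm_apply]; exact (c i).2⟩
  left_inv h := Subtype.ext (Λ.symm_apply_apply h)
  right_inv c := funext fun i => Subtype.ext (congrFun (Λ.apply_symm_apply fun i => (c i : K)) i)
  map_add' x y := funext fun i => Subtype.ext (congrFun (map_add Λ (x : H) y) i)
  map_mul' x y := funext fun i => Subtype.ext (congrFun (map_mul Λ (x : H) y) i)
  commutes' c := funext fun i => Subtype.ext (congrFun (Λ.commutes (c : K)) i)

theorem coe_associatedOrderEquiv_apply (h : associatedOrder p K H L) (i : ι) :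
    (associatedOrderEquiv hΛ hb h i : K) = Λ h i :=
  rfl

section

variable [Fintype ι]

/-- The basis of the associated order consisting of the projections onto the lines spanned by the
vectors of `b`. -/
def associatedOrderBasis : Module.Basis ι (ringOfIntegers p K) (associatedOrder p K H L) :=
  .ofEquivFun (associatedOrderEquiv hΛ hb).toLinearEquiv

variable [DecidableEq ι]

theorem associatedOrderEquiv_basis (i : ι) :
    associatedOrderEquiv hΛ hb (associatedOrderBasis hΛ hb i) = Pi.single i 1 := by
  rw [associatedOrderBasis, Module.Basis.coe_ofEquivFun]
  exact AlgEquiv.apply_symm_apply _ _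

theorem associatedOrderBasis_mul (i j : ι) :
    associatedOrderBasis hΛ hb i * associatedOrderBasis hΛ hb j =
      if i = j then associatedOrderBasis hΛ hb i else 0 := by
  apply (associatedOrderEquiv hΛ hb).injective
  rw [map_mul, associatedOrderEquiv_basis, associatedOrderEquiv_basis]
  split_ifs with hij
  · rw [associatedOrderEquiv_basis, hij, ← Pi.single_mul, one_mul]
  · rw [map_zero, ← Pi.single_mul_right, Pi.single_eq_of_ne (Ne.symm hij), zero_mul, Pi.single_zero]

theorem associatedOrderBasis_smul (i j : ι) :
    (associatedOrderBasis hΛ hb i : H) • b j = if i = j then b j else 0 := by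
  rw [hΛ, ← coe_associatedOrderEquiv_apply hΛ hb, associatedOrderEquiv_basis]
  split_ifs with hij
  · rw [hij, Pi.single_eq_same, OneMemClass.coe_one, one_smul]
  · rw [Pi.single_eq_of_ne (Ne.symm hij), ZeroMemClass.coe_zero, zero_smul]

end

variable [Finite ι]

theorem span_associatedOrder_eq_top :
    Submodule.span K (associatedOrder p K H L : Set H) = ⊤ := by
  classical
  have := Fintype.ofFinite ι
  rw [eq_top_iff]
  rintro h -
  have hΛv (i : ι) : Λ (associatedOrderBasis hΛ hb i : H) = Pi.single i 1 := by
    ext j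
    rw [← coe_associatedOrderEquiv_apply hΛ hb, associatedOrderEquiv_basis]
    obtain rfl | hij := eq_or_ne j i
    · simp
    · simp [hij]
  have hsum : h = ∑ i, Λ h i • (associatedOrderBasis hΛ hb i : H) := by
    apply Λ.injective
    simp only [map_sum, map_smul, hΛv]
    exact pi_eq_sum_univ' (Λ h)
  rw [hsum]
  exact sum_mem fun i _ => Submodule.smul_mem _ _
    (Submodule.subset_span (associatedOrderBasis hΛ hb i).2)

theorem isTheMaximalOrder_associatedOrder [Algebra.IsAlgebraic ℚ_[p] K] :
    IsTheMaximalOrder p K (associatedOrder p K H L) := by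
  refine ⟨⟨?_, span_associatedOrder_eq_top hΛ hb⟩, ?_⟩
  · have := Fintype.ofFinite ι
    exact Module.Finite.iff_fg.1 (Module.Finite.of_basis (associatedOrderBasis hΛ hb))
  · rintro Γ ⟨hΓ, -⟩ h hh
    refine (mem_associatedOrder_iff hΛ hb).2 fun i => (padicVal_le_one_iff p).1 ?_
    have hint : IsIntegral (ringOfIntegers p K) h := IsIntegral.of_mem_of_fg Γ hΓ h hh
    exact (integers_padicVal p).mem_of_integral
      (hint.map (((Pi.evalAlgHom K (fun _ : ι => K) i).comp
        (Λ : H →ₐ[K] (ι → K))).restrictScalars (ringOfIntegers p K)))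

theorem free_ringOfIntegers : Module.Free (associatedOrder p K H L) (ringOfIntegers p L) := by
  have := Fintype.ofFinite ι
  let θ : ringOfIntegers p L := ⟨∑ i, b i, sum_mem fun i _ => hb.mem i⟩
  have hθ (h : H) (i : ι) : b.repr (h • (θ : L)) i = Λ h i := by
    rw [repr_smul_eq_mul hΛ]
    simp [θ]
  have hbij : Function.Bijective (LinearMap.toSpanSingleton (associatedOrder p K H L) _ θ) := by
    constructor
    · intro x y hxy
      have hxy : (x : H) • (θ : L) = (y : H) • (θ : L) := congrArg Subtype.val hxy
      exact Subtype.ext (Λ.injective (funext fun i => by rw [← hθ, ← hθ, hxy]))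
    · intro x
      refine ⟨(associatedOrderEquiv hΛ hb).symm fun i => ⟨_, (hb x).1 x.2 i⟩,
        Subtype.ext (b.repr.injective (Finsupp.ext fun i => (hθ _ i).trans ?_))⟩
      exact congrArg Subtype.val (congrFun ((associatedOrderEquiv hΛ hb).apply_symm_apply _) i)
  exact Module.Free.of_equiv (LinearEquiv.ofBijective _ hbij)

end DiagonalAction

section KummerBasis

variable {p : ℕ} [Fact p.Prime] {K L : Type*} [Field K] [Algebra ℚ_[p] K]
  [Field L] [Algebra ℚ_[p] L] [Algebra K L] [IsScalarTower ℚ_[p] K L]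
  [FiniteDimensional ℚ_[p] K] [FiniteDimensional ℚ_[p] L]

theorem IsTotallyRamifiedGenerator.isIntegralBasis_powBasis {α : L}
    (h : IsTotallyRamifiedGenerator K (padicVal p L) p α) (hdeg : Module.finrank K L = p) :
    IsIntegralBasis p (h.powBasis hdeg) := by
  intro x
  have hsum : x = ∑ i, (h.powBasis hdeg).repr x i • α ^ (i : ℕ) := by
    simpa only [powBasis_apply] using ((h.powBasis hdeg).sum_repr x).symm
  constructor
  · intro hx i
    obtain hi | hi := eq_or_ne ((h.powBasis hdeg).repr x i) 0
    · exact hi ▸ zero_mem _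
    obtain ⟨k, hk⟩ := h.exists_zpow_eq _ hi
    have hle : padicVal p L α ^ (p * k + (i : ℕ) : ℤ) ≤ 1 := by
      rw [zpow_add₀ h.pos.ne', zpow_natCast, ← hk, ← map_pow, ← map_mul, ← Algebra.smul_def]
      refine (h.valuation_smul_pow_le _ i).trans ?_
      rw [← hsum]
      exact (padicVal_le_one_iff p).2 hx
    have hk0 : 0 ≤ k := by
      have hnonneg := (zpow_le_one_iff_right_of_lt_one₀ h.pos h.lt_one).1 hle
      have hip := i.isLt
      by_contra! hneg
      nlinarith
    rw [← padicVal_le_one_iff, ← padicVal_algebraMap (E := L), hk]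
    exact (zpow_le_one_iff_right_of_lt_one₀ h.pos h.lt_one).2 (by positivity)
  · intro hx
    have hα : α ∈ ringOfIntegers p L := (padicVal_le_one_iff p).1 h.lt_one.le
    rw [hsum]
    exact sum_mem fun i _ => smul_mem_ringOfIntegers p ⟨_, hx i⟩ (pow_mem hα _)

theorem IsTotallyRamifiedGenerator.notMem_range_algebraMap {Γ₀ : Type*}
    [LinearOrderedCommGroupWithZero Γ₀] {v : Valuation L Γ₀} {n : ℕ} (hn : n ≠ 1) {α : L}
    (h : IsTotallyRamifiedGenerator K v n α) : α ∉ Set.range (algebraMap K L) := by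
  rintro ⟨c, rfl⟩
  obtain ⟨k, hk⟩ := h.exists_zpow_eq c fun hc => h.ne_zero (by rw [hc, map_zero])
  have hone : (1 : ℤ) = n * k :=
    zpow_right_injective₀ h.pos h.lt_one.ne ((zpow_one _).trans hk)
  exact hn (Int.natCast_dvd_natCast.1 ⟨k, hone⟩ |> Nat.dvd_one.1)

variable {H : Type*} [Ring H] [HopfAlgebra K H] [Module H L] [IsScalarTower K H L]

theorem IsGeneratingRoot.exists_algEquiv_smul_powBasis_eq (hH : IsHopfGalois K H L)
    (hdeg : Module.finrank K L = p) {α : L} (hα : IsGeneratingRoot p K α) :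
    ∃ Λ : H ≃ₐ[K] (Fin p → K), ∀ (h : H) (i : Fin p),
      h • hα.isTotallyRamifiedGenerator.powBasis hdeg i =
        Λ h i • hα.isTotallyRamifiedGenerator.powBasis hdeg i := by
  have : CharZero K := charZero_of_injective_algebraMap (algebraMap ℚ_[p] K).injective
  obtain ⟨⟨ϖ, -, hϖ⟩, -⟩ := id hα
  refine exists_algEquiv_smul_basis_eq hH fun h i => ?_
  rw [IsTotallyRamifiedGenerator.powBasis_apply]
  exact exists_smul_pow_eq_smul_pow hH hdeg
    (hα.isTotallyRamifiedGenerator.notMem_range_algebraMap (Fact.out : p.Prime).ne_one)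
    ⟨ϖ, hϖ.symm⟩ h i

end KummerBasis

end HopfGaloisPadic

end

open HopfGaloisPadic in
theorem mainTheorem3_general (p : ℕ) [Fact p.Prime]
    (K L E H : Type*)
    [Field K] [Algebra ℚ_[p] K] [FiniteDimensional ℚ_[p] K]
    [Field L] [Algebra ℚ_[p] L] [Algebra K L] [IsScalarTower ℚ_[p] K L]
    (hdeg : Module.finrank K L = p)
    [Field E] [Algebra ℚ_[p] E] [Algebra K E] [Algebra L E]
    [IsScalarTower ℚ_[p] K E] [IsScalarTower ℚ_[p] L E] [IsScalarTower K L E]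
    [IsNormalClosure K L E]
    [Ring H] [HopfAlgebra K H] [Module H L] [IsScalarTower K H L]
    (hH : IsHopfGalois K H L)
    (hram : IsMaximallyRamified p K L E ∨ ∃ α : L, IsGeneratingRoot p K α) :
    (∃ α : L, IsGeneratingRoot p K α) ∧
    (∀ α : L, IsGeneratingRoot p K α →
      ∃ v : Module.Basis (Fin p) (ringOfIntegers p K) (associatedOrder p K H L),
        (∀ i j, v i * v j = if i = j then v i else 0) ∧
        (∀ i j : Fin p, (v i : H) • α ^ (j : ℕ) = if i = j then α ^ (j : ℕ) else 0)) ∧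
    IsTheMaximalOrder p K (associatedOrder p K H L) ∧
    Module.Free (associatedOrder p K H L) (ringOfIntegers p L) := by
  have : FiniteDimensional K L :=
    Module.finite_of_finrank_pos (hdeg ▸ (Fact.out : p.Prime).pos)
  have : FiniteDimensional ℚ_[p] L := .trans ℚ_[p] K L
  have hroot : ∃ α : L, IsGeneratingRoot p K α :=
    hram.elim (fun h => h.exists_isGeneratingRoot hdeg) id
  refine ⟨hroot, fun α hα => ?_, ?_⟩
  · have hα' := hα.isTotallyRamifiedGenerator
    have hb := hα'.isIntegralBasis_powBasis hdeg
    obtain ⟨Λ, hΛ⟩ := hα.exists_algEquiv_smul_powBasis_eq hH hdeg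
    refine ⟨associatedOrderBasis hΛ hb, associatedOrderBasis_mul hΛ hb, fun i j => ?_⟩
    simpa only [hα'.powBasis_apply] using associatedOrderBasis_smul hΛ hb i j
  · obtain ⟨α, hα⟩ := hroot
    have hb := hα.isTotallyRamifiedGenerator.isIntegralBasis_powBasis hdeg
    obtain ⟨Λ, hΛ⟩ := hα.exists_algEquiv_smul_powBasis_eq hH hdeg
    exact ⟨isTheMaximalOrder_associatedOrder hΛ hb, free_ringOfIntegers hΛ hb⟩

open HopfGaloisPadic in
theorem mainTheorem3 (p : ℕ) [Fact p.Prime] (hp : p ≠ 2)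
    (K L E H : Type*)
    -- `L/K` is an extension of degree `p` of `p`-adic fields
    [Field K] [Algebra ℚ_[p] K] [FiniteDimensional ℚ_[p] K]
    [Field L] [Algebra ℚ_[p] L] [Algebra K L] [IsScalarTower ℚ_[p] K L]
    (hdeg : Module.finrank K L = p)
    -- `E` is the normal closure of `L/K`
    [Field E] [Algebra ℚ_[p] E] [Algebra K E] [Algebra L E]
    [IsScalarTower ℚ_[p] K E] [IsScalarTower ℚ_[p] L E] [IsScalarTower K L E]
    [IsNormalClosure K L E]
    -- `H` is a Hopf-Galois structure on `L/K`
    [Ring H] [HopfAlgebra K H] [Module H L] [IsScalarTower K H L]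
    (hH : IsHopfGalois K H L)
    -- the maximally ramified case, in either of its two descriptions
    (hram : IsMaximallyRamified p K L E ∨ ∃ α : L, IsGeneratingRoot p K α) :
    (∃ α : L, IsGeneratingRoot p K α) ∧
    (∀ α : L, IsGeneratingRoot p K α →
      ∃ v : Module.Basis (Fin p) (ringOfIntegers p K) (associatedOrder p K H L),
        (∀ i j, v i * v j = if i = j then v i else 0) ∧
        (∀ i j : Fin p, (v i : H) • α ^ (j : ℕ) = if i = j then α ^ (j : ℕ) else 0)) ∧
    IsTheMaximalOrder p K (associatedOrder p K H L) ∧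
    Module.Free (associatedOrder p K H L) (ringOfIntegers p L) :=
  mainTheorem3_general p K L E H hdeg hH hram
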